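/- **Setting.** Let $(R_t,c_t,Z_t)_{t\in\mathbb Z}$ be a process on a probability space, where $R_t\in\mathbb R^J$ are gross asset returns, $c_t>0$ (a.s.) is consumption growth and $Z_t\in\mathbb R^q$; put $W_t=(Z_t,c_t)$, and write $e=(1,\dots,1)^T$. Let $0<\delta_0<1$, $\gamma_0\in\mathbb R$, and let $g_0:\mathbb R\to\mathbb R$ be measurable. With $A_t=\delta_0R_{t+1}c_{t+1}^{-\gamma_0}$, suppose that the pricing equation $E[A_tg_0(c_{t+1})\mid W_t]=g_0(c_t)e$ holds. Let $\Delta>0$ and $$D_t=(1+|R_{t+1}|)\,[2+|\ln c_{t+1}|^2]\sup_{\gamma\in[\gamma_0-\Delta,\gamma_0+\Delta]}c_{t+1}^{-\gamma},\qquad \|g\|_{\mathcal G}=\sqrt{E\big[E[D_t^2\mid W_t]\,g(c_{t+1})^2\big]},$$ and let $\mathcal G$ be the set of measurable $g$ with $\|g\|_{\mathcal G}<\infty$. Let $\mathcal B$ be the Hilbert space of square-integrable $J\times1$ functions of $W_t$ with inner product $E[a^Tb]$. Put $X_t=(1/\delta_0,-\ln c_{t+1})^T$, $$m'_\beta=E[A_tg_0(c_{t+1})X_t^T\mid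 W_t],\qquad m'_g g=E[A_tg(c_{t+1})\mid W_t]-g(c_t)e,$$ let $\overline{\mathcal M}$ be the closure in $\mathcal B$ of the linear span of those $m'_gg$, $g\in\mathcal G$, that are square-integrable, let $\zeta_k^*$ be the orthogonal projection of the $k$-th column $m'_\beta e_k$ on $\overline{\mathcal M}$, and let $\Pi$ be the $2\times 2$ matrix $$\Pi_{kl}=E\big[(m'_\beta e_k-\zeta^*_k)^T(m'_\beta e_l-\zeta^*_l)\big].$$ **Assumptions.** $(R_t,c_t,W_t)$ is strictly stationary, $E[D_t^2]<\infty$, $\|g_0\|_{\mathcal G}<\infty$, and $\Pr(g_0(c_t)=0)=0$. For some measurable function $w(Z_t)\in\mathbb R^k$ and $\tilde W_t=(w(Z_t),c_t)$, the vector $(c_{t+1},\tilde W_t)$ has a Lebesgue density $f_{c,\tilde W}$, with marginal densities $f_c$ of $c_{t+1}$ and $f_{\tilde W}$ of $\tilde W_t$, and for some $j$ the component $A_{tj}=\delta_0R_{t+1,j}c_{t+1}^{-\gamma_0}$ satisfies $$E\big[A_{tj}^2\,f_c(c_{t+1})^{-1}f_{\tilde W}(\tilde W_t)^{-1}f_{c,\tilde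 W}(c_{t+1},\tilde W_t)\big]<\infty .$$ **Conclusion.** The columns of $m'_\beta$ belong to $\mathcal B$ (so $\Pi$ is well defined), and the following hold. (a) If for every measurable $h$ with $A_{tj}h(c_{t+1},c_t)$ integrable, $E[A_{tj}h(c_{t+1},c_t)\mid\tilde W_t]=0$ a.s. implies $h(c_{t+1},c_t)=0$ a.s., then $\Pi$ is nonsingular. (b) Fix any version of the regular conditional distribution of $(Z_t,R_{t+1},c_{t+1})$ given $c_t$; conditional expectations given $c_t=\bar c$ are taken under this version. Let $\bar c$ be such that $g_0(\bar c)\ne0$ and such that for every measurable $h$ for which $A_{tj}h(c_{t+1})$ is integrable both unconditionally and given $c_t=\bar c$, $E[A_{tj}h(c_{t+1})\mid w(Z_t),c_t=\bar c]=0$ a.s. given $c_t=\bar c$ implies $h(c_{t+1})=0$ a.s. Call a measurable $g$ a solution if $E[A_tg(c_{t+1})\mid W_t]=g(c_t)e$ a.s., and this equation also holds at $c_t=\bar c$, i.e. $E[A_tg(c_{t+1})\mid Z_t,c_t=\bar c]=g(\bar c)e$ a.s. given $c_t=\bar c$ (with the conditional expectations well defined). If $g_0$ is a solution in this sense, then it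 is the unique solution up to scale: for every solution $g$ there is $a\in\mathbb R$ with $g(c_{t+1})=a\,g_0(c_{t+1})$ a.s. and $g(\bar c)=a\,g_0(\bar c)$. -/

import Mathlib

open MeasureTheory ProbabilityTheory
open scoped ENNReal

/-- A discrete-time process is strictly stationary if time shifts do not change its law
(the law on the space of trajectories). -/
def StrictlyStationary {Ω E : Type*} [MeasurableSpace Ω] [MeasurableSpace E]
    (P : Measure Ω) (X : ℤ → Ω → E) : Prop :=
  ∀ s : ℤ, P.map (fun ω (t : ℤ) => X (t + s) ω) = P.map (fun ω (t : ℤ) => X t ω)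

/-- The observables and the true parameters of the consumption capital asset pricing model:
`R t` are the `J` gross asset returns, `c t` is consumption growth, `Z t` are the conditioning
variables other than `c t`, `δ₀` is the rate of time preference, `γ₀` the exponent, and `g₀` the
unknown function in the marginal utility of consumption. -/
structure CCAPM {Ω : Type*} [MeasurableSpace Ω] (P : Measure Ω) (J q : ℕ) where
  R : ℤ → Ω → EuclideanSpace ℝ (Fin J)
  c : ℤ → Ω → ℝ
  Z : ℤ → Ω → (Fin q → ℝ)
  δ₀ : ℝ
  γ₀ : ℝ
  g₀ : ℝ → ℝ
  measurable_R : ∀ t, Measurable (R t)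
  measurable_c : ∀ t, Measurable (c t)
  measurable_Z : ∀ t, Measurable (Z t)
  measurable_g₀ : Measurable g₀
  c_pos : ∀ t, ∀ᵐ ω ∂P, 0 < c t ω
  δ₀_pos : 0 < δ₀
  δ₀_lt_one : δ₀ < 1

namespace CCAPM

variable {Ω : Type*} [MeasurableSpace Ω] {P : Measure Ω} {J q : ℕ}

/-- The variables observed by the agent, `W_t = (Z_t, c_t)`. -/
def W (M : CCAPM P J q) (t : ℤ) (ω : Ω) : (Fin q → ℝ) × ℝ := (M.Z t ω, M.c t ω)

/-- The σ-algebra generated by `W_t`. -/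
abbrev sigmaW (M : CCAPM P J q) (t : ℤ) : MeasurableSpace Ω :=
  MeasurableSpace.comap (M.W t) inferInstance

/-- `W̃_t = (w(Z_t), c_t)`. -/
def Wtilde {k : ℕ} (M : CCAPM P J q) (w : (Fin q → ℝ) → (Fin k → ℝ)) (t : ℤ) (ω : Ω) :
    (Fin k → ℝ) × ℝ := (w (M.Z t ω), M.c t ω)

/-- The σ-algebra generated by `W̃_t`. -/
abbrev sigmaWtilde {k : ℕ} (M : CCAPM P J q) (w : (Fin q → ℝ) → (Fin k → ℝ)) (t : ℤ) :
    MeasurableSpace Ω :=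
  MeasurableSpace.comap (M.Wtilde w t) inferInstance

/-- `δ₀ r_i s^{-γ₀}`: the discounted return on asset `i` when returns are `r` and consumption
growth is `s`. -/
noncomputable def disc (M : CCAPM P J q) (i : Fin J) (r : EuclideanSpace ℝ (Fin J)) (s : ℝ) : ℝ :=
  M.δ₀ * r i * s ^ (-M.γ₀)

/-- `A_{ti} = δ₀ R_{t+1,i} c_{t+1}^{-γ₀}`. -/
noncomputable def A (M : CCAPM P J q) (t : ℤ) (i : Fin J) (ω : Ω) : ℝ :=
  M.disc i (M.R (t + 1) ω) (M.c (t + 1) ω)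

/-- `D_t = (1 + |R_{t+1}|) [2 + |ln c_{t+1}|²] sup_{|γ - γ₀| ≤ Δ} c_{t+1}^{-γ}`. -/
noncomputable def D (M : CCAPM P J q) (Δ : ℝ) (t : ℤ) (ω : Ω) : ℝ :=
  (1 + ‖M.R (t + 1) ω‖) * (2 + |Real.log (M.c (t + 1) ω)| ^ 2) *
    ⨆ γ : Set.Icc (M.γ₀ - Δ) (M.γ₀ + Δ), M.c (t + 1) ω ^ (-(γ : ℝ))

/-- `‖g‖_𝒢 = (E[ E[D_t² | W_t] g(c_{t+1})² ])^{1/2}`, possibly infinite. -/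
noncomputable def gNorm (M : CCAPM P J q) (Δ : ℝ) (t : ℤ) (g : ℝ → ℝ) : ℝ≥0∞ :=
  (∫⁻ ω, ENNReal.ofReal ((P[fun ω' => M.D Δ t ω' ^ 2 | M.sigmaW t]) ω) *
    ‖g (M.c (t + 1) ω)‖ₑ ^ 2 ∂P) ^ (1 / 2 : ℝ)

/-- The functions `g` with finite norm. -/
def MemG (M : CCAPM P J q) (Δ : ℝ) (t : ℤ) (g : ℝ → ℝ) : Prop :=
  Measurable g ∧ M.gNorm Δ t g < ∞

/-- The regularity conditions: `(R_t, c_t, W_t)` is strictly stationary, `E[D_t²] < ∞`, and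
`‖g₀‖_𝒢 < ∞`. -/
structure Regular (M : CCAPM P J q) (Δ : ℝ) (t : ℤ) : Prop where
  stationary : StrictlyStationary P (fun s ω => (M.R s ω, M.c s ω, M.W s ω))
  D_sq : Integrable (fun ω => M.D Δ t ω ^ 2) P
  g₀_mem : M.MemG Δ t M.g₀

/-- `g` solves `E[A_t g(c_{t+1}) | W_t] = g(c_t) e` almost surely, the conditional expectations
being well defined. For `g = g₀` this is the pricing equation, multiplied through by `g₀(c_t)`. -/
def Solves (M : CCAPM P J q) (t : ℤ) (g : ℝ → ℝ) : Prop :=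
  ∀ i, Integrable (fun ω => M.A t i ω * g (M.c (t + 1) ω)) P ∧
    P[fun ω => M.A t i ω * g (M.c (t + 1) ω) | M.sigmaW t] =ᵐ[P] fun ω => g (M.c t ω)

/-- The vector `X_t = (1/δ₀, -ln c_{t+1})`. -/
noncomputable def X (M : CCAPM P J q) (t : ℤ) (k : Fin 2) (ω : Ω) : ℝ :=
  (![1 / M.δ₀, -Real.log (M.c (t + 1) ω)] : Fin 2 → ℝ) k

/-- The `k`-th column of `m'_β(W) = E[A_t g₀(c_{t+1}) X_tᵀ | W_t]`. -/
noncomputable def mBeta (M : CCAPM P J q) (t : ℤ) (k : Fin 2) (ω : Ω) :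
    EuclideanSpace ℝ (Fin J) :=
  WithLp.toLp 2 fun i =>
    (P[fun ω' => M.A t i ω' * M.g₀ (M.c (t + 1) ω') * M.X t k ω' | M.sigmaW t]) ω

/-- `m'_g g = E[A_t g(c_{t+1}) | W_t] - g(c_t) e`. -/
noncomputable def mG (M : CCAPM P J q) (t : ℤ) (g : ℝ → ℝ) (ω : Ω) :
    EuclideanSpace ℝ (Fin J) :=
  WithLp.toLp 2 fun i =>
    (P[fun ω' => M.A t i ω' * g (M.c (t + 1) ω') | M.sigmaW t]) ω - g (M.c t ω)

/-- The mean-square closure of the linear span of `m'_g g`, `g ∈ 𝒢`, in the Hilbert space of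
square-integrable `J`-vectors with inner product `E[aᵀ b]`. Since all `m'_g g` are functions of
`W_t`, it is immaterial whether the closure is taken among functions of `W_t` or not. -/
noncomputable def tangent (M : CCAPM P J q) (Δ : ℝ) (t : ℤ) :
    Submodule ℝ (Lp (EuclideanSpace ℝ (Fin J)) 2 P) :=
  (Submodule.span ℝ {f : Lp (EuclideanSpace ℝ (Fin J)) 2 P |
    ∃ g, M.MemG Δ t g ∧ f =ᵐ[P] M.mG t g}).topologicalClosure

open Classical in
/-- The `k`-th column of `m'_β` as an element of the Hilbert space. -/
noncomputable def mBetaL2 (M : CCAPM P J q) (t : ℤ) (k : Fin 2) :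
    Lp (EuclideanSpace ℝ (Fin J)) 2 P :=
  if h : MemLp (M.mBeta t k) 2 P then h.toLp (M.mBeta t k) else 0

/-- The residual `m'_β e_k - ζ*_k`, where `ζ*_k` is the orthogonal projection of `m'_β e_k` on
the closed linear span of the nonparametric directions. -/
noncomputable def resid (M : CCAPM P J q) (Δ : ℝ) (t : ℤ) (k : Fin 2) :
    Lp (EuclideanSpace ℝ (Fin J)) 2 P :=
  haveI : CompleteSpace (M.tangent Δ t) :=
    (Submodule.isClosed_topologicalClosure _).completeSpace_coe
  M.mBetaL2 t k - (M.tangent Δ t).starProjection (M.mBetaL2 t k)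

/-- The second moment matrix `Π` of the residuals. -/
noncomputable def PiMatrix (M : CCAPM P J q) (Δ : ℝ) (t : ℤ) : Matrix (Fin 2) (Fin 2) ℝ :=
  Matrix.of fun k l => ∫ ω, inner ℝ (M.resid Δ t k ω) (M.resid Δ t l ω) ∂P

/-- `E[A_{tj}² f_c(c_{t+1})⁻¹ f_W̃(W̃_t)⁻¹ f_{c,W̃}(c_{t+1}, W̃_t)] < ∞`, with Lebesgue
densities. -/
def HilbertSchmidt {k : ℕ} (M : CCAPM P J q) (w : (Fin q → ℝ) → (Fin k → ℝ)) (t : ℤ)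
    (j : Fin J) : Prop :=
  ∫⁻ ω, ‖M.A t j ω‖ₑ ^ 2 *
    (pdf (M.c (t + 1)) P volume (M.c (t + 1) ω))⁻¹ *
    (pdf (M.Wtilde w t) P volume (M.Wtilde w t ω))⁻¹ *
    pdf (fun ω' => (M.c (t + 1) ω', M.Wtilde w t ω')) P volume
      (M.c (t + 1) ω, M.Wtilde w t ω) ∂P < ∞

/-- Completeness: `E[A_{tj} h(c_{t+1}, c_t) | W̃_t] = 0` implies `h(c_{t+1}, c_t) = 0`, for all
`h` for which the conditional expectation is defined. -/
def Complete {k : ℕ} (M : CCAPM P J q) (w : (Fin q → ℝ) → (Fin k → ℝ)) (t : ℤ)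
    (j : Fin J) : Prop :=
  ∀ h : ℝ × ℝ → ℝ, Measurable h →
    Integrable (fun ω => M.A t j ω * h (M.c (t + 1) ω, M.c t ω)) P →
    P[fun ω => M.A t j ω * h (M.c (t + 1) ω, M.c t ω) | M.sigmaWtilde w t] =ᵐ[P] 0 →
    ∀ᵐ ω ∂P, h (M.c (t + 1) ω, M.c t ω) = 0

/-- `Q` is a version of the regular conditional distribution of `(Z_t, R_{t+1}, c_{t+1})` given
`c_t`. -/
def IsCondLaw (M : CCAPM P J q) (t : ℤ)
    (Q : Kernel ℝ ((Fin q → ℝ) × EuclideanSpace ℝ (Fin J) × ℝ)) : Prop :=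
  IsMarkovKernel Q ∧
    (P.map fun ω => (M.c t ω, (M.Z t ω, M.R (t + 1) ω, M.c (t + 1) ω))).IsCondKernel Q

/-- `g` solves `E[A_t g(c_{t+1}) | W_t] = g(c_t) e` at the value `c_t = cbar`, that is
`E[A_t g(c_{t+1}) | Z_t, c_t = cbar] = g(cbar) e` under the law of `(Z_t, R_{t+1}, c_{t+1})` given
`c_t = cbar`. -/
def SolvesAt (M : CCAPM P J q) (Q : Kernel ℝ ((Fin q → ℝ) × EuclideanSpace ℝ (Fin J) × ℝ))
    (cbar : ℝ) (g : ℝ → ℝ) : Prop :=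
  ∀ i, Integrable (fun p => M.disc i p.2.1 p.2.2 * g p.2.2) (Q cbar) ∧
    (Q cbar)[fun p => M.disc i p.2.1 p.2.2 * g p.2.2 |
      MeasurableSpace.comap (fun p => p.1) inferInstance] =ᵐ[Q cbar] fun _ => g cbar

/-- Completeness at `c_t = cbar`: `E[A_{tj} h(c_{t+1}) | w(Z_t), c_t = cbar] = 0` implies
`h(c_{t+1}) = 0`, for all `h` for which the conditional expectation and its value at `cbar` are
defined. -/
def CompleteAt {k : ℕ} (M : CCAPM P J q) (w : (Fin q → ℝ) → (Fin k → ℝ)) (t : ℤ) (j : Fin J)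
    (Q : Kernel ℝ ((Fin q → ℝ) × EuclideanSpace ℝ (Fin J) × ℝ)) (cbar : ℝ) : Prop :=
  ∀ h : ℝ → ℝ, Measurable h →
    Integrable (fun ω => M.A t j ω * h (M.c (t + 1) ω)) P →
    Integrable (fun p => M.disc j p.2.1 p.2.2 * h p.2.2) (Q cbar) →
    (Q cbar)[fun p => M.disc j p.2.1 p.2.2 * h p.2.2 |
      MeasurableSpace.comap (fun p => w p.1) inferInstance] =ᵐ[Q cbar] 0 →
    ∀ᵐ ω ∂P, h (M.c (t + 1) ω) = 0

end CCAPM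

/-! ### Weighted L² bounds for conditional expectations; a closed range criterion. -/

section General

/-! Write `c`, `c'` for `c_t`, `c_{t+1}`. For (a), `Π` is the Gram matrix of the residuals, so if it
is singular some combination of the columns of `m'_β`, with coefficients `b ≠ 0`, lies in the closed
span of the nonparametric directions. Take its `j`-th component and condition on `W̃`: a direction
`m'_g g` becomes `T g - S g`, where `T g = E[A_j g(c') | W̃]` and `S g = g(c)`. Stationarity makes
`S` an isometry on the L² space of the law of `c'`, and the density condition makes `T`
Hilbert-Schmidt, so `S - T` has closed range (`isClosed_range_isometry_sub`). Hence the limit of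
directions is itself given by some `g` in L² (`exists_condExp_eq_of_mem_tangent`).

This gives `E[A_j (g₀(c') (b₀/δ₀ - b₁ log c') - g(c')) | W̃] = -g(c)`. The pricing equation rewrites
`g(c)` as `E[A_j g₀(c') | W̃] g(c)/g₀(c)`, so everything moves under one conditional expectation of
a function of `(c', c)`. Completeness makes that function zero: with `G = g/g₀`, `b₀/δ₀ - b₁ log c'
= G(c') - G(c)`.

Such an identity is rigid (`affine_log_eq_zero_of_eq_increment`). The joint law of `(c', c)` is
absolutely continuous with respect to the product of its marginals, so a function of `c'` equal to a
function of `c` lives on countably many values. If `b₁ ≠ 0`, then `G(c') + b₁ log c'` and `G(c')`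
are both so confined, hence so is `c'`, which has a density. If `b₁ = 0`, then `G(c')` and `G(c)`
have the same law and differ by the constant `b₀/δ₀`, which must vanish. So `b = 0`, a
contradiction.

For (b), subtract from a solution `g` the multiple of `g₀` that agrees with it at `cbar`; the
difference has zero conditional mean at `cbar`, and completeness there kills it. -/

theorem eLpNorm_two_sq_eq_lintegral {α : Type*} [MeasurableSpace α] (μ : Measure α) (f : α → ℝ) :
    eLpNorm f 2 μ ^ 2 = ∫⁻ x, ‖f x‖ₑ ^ 2 ∂μ := by
  have h := eLpNorm_nnreal_pow_eq_lintegral (μ := μ) (f := f) (p := 2) two_ne_zero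
  simpa using h

theorem eLpNorm_two_eq_lintegral_rpow {α : Type*} [MeasurableSpace α] (μ : Measure α)
    (f : α → ℝ) : eLpNorm f 2 μ = (∫⁻ x, ‖f x‖ₑ ^ 2 ∂μ) ^ (1 / 2 : ℝ) := by
  rw [← eLpNorm_two_sq_eq_lintegral, ← ENNReal.rpow_natCast, ← ENNReal.rpow_mul]
  norm_num

theorem lintegral_enorm_sq_eq_ofReal_integral {α : Type*} [MeasurableSpace α] {μ : Measure α}
    {f : α → ℝ} (hf : MemLp f 2 μ) :
    ∫⁻ x, ‖f x‖ₑ ^ 2 ∂μ = ENNReal.ofReal (∫ x, f x ^ 2 ∂μ) := by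
  rw [ofReal_integral_eq_lintegral_ofReal hf.integrable_sq (ae_of_all _ fun x => sq_nonneg _)]
  refine lintegral_congr fun x => ?_
  rw [← sq_abs, ENNReal.ofReal_pow (abs_nonneg _), ← Real.enorm_eq_ofReal_abs]

/-- A weighted Cauchy-Schwarz inequality; the weight may degenerate where `f` vanishes. -/
theorem lintegral_enorm_mul_le_weighted {α : Type*} [MeasurableSpace α] {μ : Measure α}
    {f g : α → ℝ} {ρ : α → ℝ≥0∞} (hf : AEMeasurable f μ) (hg : AEMeasurable g μ)
    (hρ : AEMeasurable ρ μ) (h : ∀ᵐ x ∂μ, f x = 0 ∨ (ρ x ≠ 0 ∧ ρ x ≠ ∞)) :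
    ∫⁻ x, ‖f x * g x‖ₑ ∂μ ≤
      (∫⁻ x, ‖f x‖ₑ ^ 2 * ρ x ∂μ) ^ (1 / 2 : ℝ) *
        (∫⁻ x, ‖g x‖ₑ ^ 2 * (ρ x)⁻¹ ∂μ) ^ (1 / 2 : ℝ) := by
  have key := ENNReal.lintegral_mul_le_Lp_mul_Lq μ (p := 2) (q := 2) Real.HolderConjugate.two_two
    (f := fun x => ‖f x‖ₑ * ρ x ^ (1 / 2 : ℝ)) (g := fun x => ‖g x‖ₑ * (ρ x)⁻¹ ^ (1 / 2 : ℝ))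
    (hf.enorm.mul (hρ.pow_const _)) (hg.enorm.mul (hρ.inv.pow_const _))
  have hsq : ∀ a b : ℝ≥0∞, (a * b ^ (1 / 2 : ℝ)) ^ (2 : ℝ) = a ^ 2 * b := by
    intro a b
    rw [ENNReal.mul_rpow_of_nonneg _ _ (by norm_num), ← ENNReal.rpow_mul]
    norm_num
  simp only [hsq] at key
  refine le_trans (lintegral_mono_ae ?_) key
  filter_upwards [h] with x hx
  rcases hx with hx | ⟨h0, ht⟩
  · simp [hx]
  · rw [Pi.mul_apply, mul_mul_mul_comm, ← ENNReal.mul_rpow_of_nonneg _ _ (by norm_num),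
      ENNReal.mul_inv_cancel h0 ht, ENNReal.one_rpow, mul_one, enorm_mul]

/-- The conditional expectation of a nonnegative function can be taken out of the integral
against any function that is measurable with respect to the sub-σ-algebra. -/
theorem lintegral_ofReal_condExp_mul {Ω : Type*} {m m0 : MeasurableSpace Ω} {P : Measure Ω}
    [IsFiniteMeasure P] (hm : m ≤ m0) {F : Ω → ℝ} (hF : Integrable F P) (hF0 : 0 ≤ᵐ[P] F)
    {φ : Ω → ℝ≥0∞} (hφ : Measurable[m] φ) :
    ∫⁻ ω, ENNReal.ofReal ((P[F | m]) ω) * φ ω ∂P = ∫⁻ ω, ENNReal.ofReal (F ω) * φ ω ∂P := by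
  have hV := condLExp_ofReal m hF hF0
  have hmeas : AEMeasurable (fun ω => ENNReal.ofReal (F ω)) P := hF.1.aemeasurable.ennreal_ofReal
  have hmeas' : AEMeasurable (fun ω => ENNReal.ofReal ((P[F | m]) ω)) P :=
    integrable_condExp.1.aemeasurable.ennreal_ofReal
  have hφ0 : AEMeasurable φ P := (hφ.mono hm le_rfl).aemeasurable
  -- Both densities define the same measure on the sub-σ-algebra, and the integral of `φ` sees
  -- nothing else.
  have htrim : (P.withDensity fun ω => ENNReal.ofReal ((P[F | m]) ω)).trim hm =
      (P.withDensity fun ω => ENNReal.ofReal (F ω)).trim hm := by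
    refine @Measure.ext _ m _ _ fun s hs => ?_
    rw [trim_measurableSet_eq hm hs, trim_measurableSet_eq hm hs, withDensity_apply _ (hm s hs),
      withDensity_apply _ (hm s hs),
      ← setLIntegral_condLExp (hm := hm) P (fun ω => ENNReal.ofReal (F ω)) hs]
    exact lintegral_congr_ae (ae_restrict_of_ae (hV.mono fun ω h => h.symm))
  have h1 := lintegral_withDensity_eq_lintegral_mul₀ hmeas hφ0
  have h2 := lintegral_withDensity_eq_lintegral_mul₀ hmeas' hφ0
  simp only [Pi.mul_apply] at h1 h2
  rw [← h1, ← h2, ← lintegral_trim hm hφ, htrim, lintegral_trim hm hφ]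

/-- A conditional expectation is square-integrable if the function is bounded, as a functional
on square-integrable functions that are measurable with respect to the sub-σ-algebra. -/
theorem eLpNorm_condExp_le_of_lintegral_mul_le {Ω : Type*} {m m0 : MeasurableSpace Ω}
    {P : Measure Ω} [IsFiniteMeasure P] (hm : m ≤ m0) {f : Ω → ℝ} (hf : Integrable f P)
    {C : ℝ≥0∞}
    (h : ∀ ψ : Ω → ℝ, Measurable[m] ψ → ∫⁻ ω, ‖f ω * ψ ω‖ₑ ∂P ≤ C * eLpNorm ψ 2 P) :
    eLpNorm (P[f | m]) 2 P ≤ C := by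
  set u := P[f | m] with hu
  have hum : Measurable[m] u := stronglyMeasurable_condExp.measurable
  -- `u` is not yet known to be square-integrable, so it is tested against its bounded truncations:
  -- `‖ψ n‖² = E[f ψ n] ≤ C ‖ψ n‖`. Cancel one factor and let `n → ∞` by Fatou.
  set ψ : ℕ → Ω → ℝ := fun n => {ω | |u ω| ≤ n}.indicator u with hψ
  have hset : ∀ n : ℕ, MeasurableSet[m] {ω | |u ω| ≤ n} := fun n =>
    measurableSet_le (continuous_abs.measurable.comp hum) measurable_const
  have hψm : ∀ n, Measurable[m] (ψ n) := fun n => hum.indicator (hset n)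
  have hψb : ∀ n ω, ‖ψ n ω‖ ≤ n := by
    intro n ω
    by_cases hω : |u ω| ≤ n
    · simp [hψ, hω]
    · simp [hψ, hω]
  have hψL : ∀ n, MemLp (ψ n) 2 P := fun n =>
    MemLp.of_bound ((hψm n).mono hm le_rfl).aestronglyMeasurable n (ae_of_all _ (hψb n))
  have hbound : ∀ n, eLpNorm (ψ n) 2 P ≤ C := by
    intro n
    have hint : Integrable (fun ω => f ω * ψ n ω) P :=
      hf.mul_bdd ((hψm n).mono hm le_rfl).aestronglyMeasurable (ae_of_all _ (hψb n))
    have hpull : P[fun ω => f ω * ψ n ω | m] =ᵐ[P] fun ω => u ω * ψ n ω :=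
      condExp_mul_of_stronglyMeasurable_right (hψm n).stronglyMeasurable hint hf
    have h1 : ∫ ω, ψ n ω ^ 2 ∂P = ∫ ω, f ω * ψ n ω ∂P := by
      rw [← integral_condExp hm (f := fun ω => f ω * ψ n ω), integral_congr_ae hpull]
      refine integral_congr_ae (ae_of_all _ fun ω => ?_)
      by_cases hω : |u ω| ≤ n
      · simp [hψ, hω, sq]
      · simp [hψ, hω]
    have h2 : eLpNorm (ψ n) 2 P ^ 2 ≤ C * eLpNorm (ψ n) 2 P := by
      rw [eLpNorm_two_sq_eq_lintegral, lintegral_enorm_sq_eq_ofReal_integral (hψL n), h1]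
      refine le_trans ?_ (h (ψ n) (hψm n))
      refine le_trans (ENNReal.ofReal_le_ofReal (le_abs_self _)) ?_
      rw [← Real.norm_eq_abs, ofReal_norm]
      exact enorm_integral_le_lintegral_enorm _
    rcases eq_or_ne (eLpNorm (ψ n) 2 P) 0 with h0 | h0
    · simp [h0]
    · rw [sq] at h2
      exact (ENNReal.mul_le_mul_iff_left h0 (hψL n).2.ne).1 h2
  refine (Lp.eLpNorm_lim_le_liminf_eLpNorm (f := ψ)
    (fun n => ((hψm n).mono hm le_rfl).aestronglyMeasurable) u (ae_of_all _ fun ω => ?_)).trans ?_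
  · refine tendsto_const_nhds.congr' ?_
    obtain ⟨N, hN⟩ := exists_nat_ge |u ω|
    filter_upwards [Filter.eventually_ge_atTop N] with n hn
    have : |u ω| ≤ n := hN.trans (by exact_mod_cast hn)
    simp [hψ, this]
  · exact (Filter.liminf_le_liminf (Filter.Eventually.of_forall hbound)).trans (by simp)

/-- If `|a| ≤ d` with `d` square-integrable, and `E[E[d² | m] g²] < ∞`, then `a g` is integrable
and `E[a g | m]` is square-integrable. -/
theorem integrable_mul_and_memLp_condExp {Ω : Type*} {m m0 : MeasurableSpace Ω}
    {P : Measure Ω} [IsProbabilityMeasure P] (hm : m ≤ m0) {a d g : Ω → ℝ}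
    (ha : AEStronglyMeasurable a P) (hg : AEStronglyMeasurable g P) (had : ∀ᵐ ω ∂P, |a ω| ≤ d ω)
    (hd : Integrable (fun ω => d ω ^ 2) P)
    (hdg : ∫⁻ ω, ENNReal.ofReal ((P[fun ω' => d ω' ^ 2 | m]) ω) * ‖g ω‖ₑ ^ 2 ∂P < ∞) :
    Integrable (fun ω => a ω * g ω) P ∧ MemLp (P[fun ω => a ω * g ω | m]) 2 P := by
  set V : Ω → ℝ≥0∞ := fun ω => ENNReal.ofReal ((P[fun ω' => d ω' ^ 2 | m]) ω) with hV
  have hVm : Measurable[m] V := stronglyMeasurable_condExp.measurable.ennreal_ofReal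
  have hVm0 : Measurable V := hVm.mono hm le_rfl
  have hd0 : 0 ≤ᵐ[P] fun ω => d ω ^ 2 := ae_of_all _ fun ω => sq_nonneg _
  have hdm : AEMeasurable (fun ω => ENNReal.ofReal (d ω ^ 2)) P :=
    hd.1.aemeasurable.ennreal_ofReal
  -- Where the conditional second moment of `d` vanishes, so do `d` and `a`; this allows the weight
  -- `V⁻¹` to be infinite there.
  have ha0 : ∀ᵐ ω ∂P, V ω = 0 → a ω = 0 := by
    have hs : MeasurableSet[m] {ω | V ω = 0} := hVm (measurableSet_singleton _)
    have h1 := lintegral_ofReal_condExp_mul hm hd hd0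
      (φ := {ω | V ω = 0}.indicator fun _ => 1)
      ((@measurable_const ℝ≥0∞ Ω _ m 1).indicator hs)
    have h2 : ∫⁻ ω, V ω * {ω | V ω = 0}.indicator (fun _ => 1) ω ∂P = 0 := by
      rw [← lintegral_zero (μ := P)]
      refine lintegral_congr fun ω => ?_
      by_cases h : V ω = 0 <;> simp [h]
    rw [h2] at h1
    have h3 := (lintegral_eq_zero_iff' (hdm.mul
      ((measurable_const.indicator (hm _ hs)).aemeasurable))).1 h1.symm
    filter_upwards [h3, had] with ω h hω hVω
    have h4 : ENNReal.ofReal (d ω ^ 2) = 0 := by simpa [hVω] using h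
    have h5 : d ω = 0 := by
      have := ENNReal.ofReal_eq_zero.1 h4
      nlinarith [sq_nonneg (d ω)]
    exact abs_nonpos_iff.1 (h5 ▸ hω)
  set I := (∫⁻ ω, V ω * ‖g ω‖ₑ ^ 2 ∂P) ^ (1 / 2 : ℝ) with hI
  have hIt : I < ∞ := ENNReal.rpow_lt_top_of_nonneg (by norm_num) hdg.ne
  have hbound : ∀ ψ : Ω → ℝ, Measurable[m] ψ →
      ∫⁻ ω, ‖a ω * g ω * ψ ω‖ₑ ∂P ≤ I * eLpNorm ψ 2 P := by
    intro ψ hψ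
    have hψ0 : Measurable ψ := hψ.mono hm le_rfl
    -- The factor `ψ` is put with `a`, not with `g`: since `a² ≤ d²` and `V = E[d² | m]`, the term
    -- `E[a² ψ² / V]` is at most `E[ψ²]`, and the other term is the assumed finite integral.
    have h1 := lintegral_enorm_mul_le_weighted (μ := P) (f := fun ω => a ω * ψ ω) (g := g)
      (ρ := fun ω => (V ω)⁻¹) (ha.aemeasurable.mul hψ0.aemeasurable) hg.aemeasurable
      hVm0.inv.aemeasurable (by
        filter_upwards [ha0] with ω hω
        by_cases h : V ω = 0
        · simp [hω h]
        · exact Or.inr ⟨ENNReal.inv_ne_zero.2 ENNReal.ofReal_ne_top, ENNReal.inv_ne_top.2 h⟩)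
    have h2 : ∫⁻ ω, ‖a ω * ψ ω‖ₑ ^ 2 * (V ω)⁻¹ ∂P ≤ ∫⁻ ω, ‖ψ ω‖ₑ ^ 2 ∂P := by
      calc ∫⁻ ω, ‖a ω * ψ ω‖ₑ ^ 2 * (V ω)⁻¹ ∂P
          ≤ ∫⁻ ω, ENNReal.ofReal (d ω ^ 2) *
              {ω | V ω ≠ 0}.indicator (fun ω => ‖ψ ω‖ₑ ^ 2 * (V ω)⁻¹) ω ∂P := by
            refine lintegral_mono_ae ?_
            filter_upwards [had, ha0] with ω h1 h2
            by_cases h : V ω = 0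
            · simp [h2 h]
            · have h3 : ‖a ω‖ₑ ^ 2 ≤ ENNReal.ofReal (d ω ^ 2) := by
                rw [Real.enorm_eq_ofReal_abs, ← ENNReal.ofReal_pow (abs_nonneg _)]
                exact ENNReal.ofReal_le_ofReal (pow_le_pow_left₀ (abs_nonneg _) h1 2)
              rw [Set.indicator_of_mem (show ω ∈ {ω | V ω ≠ 0} from h), enorm_mul, mul_pow,
                mul_assoc]
              gcongr
        _ = ∫⁻ ω, V ω * {ω | V ω ≠ 0}.indicator (fun ω => ‖ψ ω‖ₑ ^ 2 * (V ω)⁻¹) ω ∂P := by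
            refine (lintegral_ofReal_condExp_mul hm hd hd0 ?_).symm
            exact ((by fun_prop : Measurable fun p : ℝ × ℝ≥0∞ => ‖p.1‖ₑ ^ 2 * p.2⁻¹).comp
              (hψ.prodMk hVm)).indicator
              (hVm (measurableSet_singleton (0 : ℝ≥0∞)).compl)
        _ ≤ ∫⁻ ω, ‖ψ ω‖ₑ ^ 2 ∂P := by
            refine lintegral_mono fun ω => ?_
            by_cases h : V ω = 0
            · simp [h]
            · rw [Set.indicator_of_mem (show ω ∈ {ω | V ω ≠ 0} from h), mul_left_comm,
                ENNReal.mul_inv_cancel h ENNReal.ofReal_ne_top, mul_one]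
    simp only [inv_inv] at h1
    calc ∫⁻ ω, ‖a ω * g ω * ψ ω‖ₑ ∂P = ∫⁻ ω, ‖a ω * ψ ω * g ω‖ₑ ∂P := by
          refine lintegral_congr fun ω => ?_
          rw [mul_right_comm]
      _ ≤ _ := h1
      _ ≤ eLpNorm ψ 2 P * I := by
          rw [eLpNorm_two_eq_lintegral_rpow, hI]
          simp only [mul_comm (V _)]
          gcongr
      _ = I * eLpNorm ψ 2 P := mul_comm _ _
  have hint : Integrable (fun ω => a ω * g ω) P := by
    refine ⟨ha.mul hg, ?_⟩
    have h1 := hbound (fun _ => 1) measurable_const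
    simp only [mul_one] at h1
    refine h1.trans_lt (ENNReal.mul_lt_top hIt ?_)
    exact (memLp_const (1 : ℝ)).2
  exact ⟨hint, integrable_condExp.1,
    (eLpNorm_condExp_le_of_lintegral_mul_le hm hint hbound).trans_lt hIt⟩

/-- An isometry minus an operator of Hilbert-Schmidt type has closed range. -/
theorem isClosed_range_isometry_sub {ι H K : Type*} [NormedAddCommGroup H]
    [InnerProductSpace ℝ H] [CompleteSpace H] [NormedAddCommGroup K] [InnerProductSpace ℝ K]
    [CompleteSpace K] (b : HilbertBasis ι ℝ H) (S T : H →L[ℝ] K) (hS : ∀ x, ‖S x‖ = ‖x‖)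
    (hT : Summable fun i => ‖T (b i)‖ ^ 2) :
    IsClosed ((S - T).toLinearMap.range : Set K) := by
  classical
  -- Outside the finite set `s` the squared norms of `T (b i)` sum to less than `1/4`, so by
  -- Cauchy-Schwarz `T` has norm at most `1/2` on vectors orthogonal to `b i`, `i ∈ s`. There `S -
  -- T` is bounded below by `1/2`.
  obtain ⟨s, hs⟩ := (summable_iff_vanishing_norm.1 hT) (1 / 4) (by norm_num)
  set L : H →L[ℝ] (s → ℝ) := ContinuousLinearMap.pi fun i => innerSL ℝ (b i) with hL
  set V : Submodule ℝ H := L.toLinearMap.ker with hV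
  have : V.CoFG := Submodule.CoFG.ker _
  have hVclosed : IsClosed (V : Set H) := L.isClosed_ker
  have hVmem : ∀ x ∈ V, ∀ i ∈ s, inner ℝ (b i) x = 0 := by
    intro x hx i hi
    have := congrFun (LinearMap.mem_ker.1 hx) ⟨i, hi⟩
    simpa [hL] using this
  have hTV : ∀ x ∈ V, ‖T x‖ ≤ ‖x‖ / 2 := by
    intro x hx
    have hsum := (b.hasSum_repr x).mapL T
    refine le_of_tendsto hsum.norm (Filter.Eventually.of_forall fun F => ?_)
    have h0 : ∑ i ∈ F, T (b.repr x i • b i) = ∑ i ∈ F \ s, T (b.repr x i • b i) := by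
      symm
      refine Finset.sum_subset Finset.sdiff_subset fun i hi hi' => ?_
      have : i ∈ s := by
        by_contra h
        exact hi' (Finset.mem_sdiff.2 ⟨hi, h⟩)
      rw [b.repr_apply_apply, hVmem x hx i this, zero_smul, map_zero]
    have hcs := Finset.sum_mul_sq_le_sq_mul_sq (F \ s) (fun i => ‖b.repr x i‖)
      (fun i => ‖T (b i)‖)
    have h1 : ∑ i ∈ F \ s, ‖b.repr x i‖ ^ 2 ≤ ‖x‖ ^ 2 := by
      simp only [b.repr_apply_apply]
      exact b.orthonormal.sum_inner_products_le x
    have h2 : ∑ i ∈ F \ s, ‖T (b i)‖ ^ 2 < 1 / 4 := by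
      have := hs (F \ s) Finset.sdiff_disjoint
      rwa [Real.norm_of_nonneg (Finset.sum_nonneg fun i _ => sq_nonneg _)] at this
    have h3 : ‖∑ i ∈ F \ s, T (b.repr x i • b i)‖ ≤
        ∑ i ∈ F \ s, ‖b.repr x i‖ * ‖T (b i)‖ := by
      refine (norm_sum_le _ _).trans (Finset.sum_le_sum fun i _ => ?_)
      rw [map_smul, norm_smul]
    rw [h0]
    refine h3.trans (abs_le_of_sq_le_sq' ?_ (by positivity)).2
    refine hcs.trans ?_
    have h4 : 0 ≤ ∑ i ∈ F \ s, ‖T (b i)‖ ^ 2 := Finset.sum_nonneg fun i _ => sq_nonneg _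
    nlinarith [sq_nonneg ‖x‖]
  -- The full range is the image of `V` plus a finite-dimensional space, so closedness of the image
  -- of `V` suffices.
  refine LinearMap.isClosed_range_of_isClosed_map_of_finiteDimensional_quotient (s := V) ?_
  have hanti : AntilipschitzWith 2 ((S - T).comp V.subtypeL) := by
    refine AddMonoidHomClass.antilipschitz_of_bound _ fun x => ?_
    have h1 := hTV x x.2
    have h2 : ‖S x‖ - ‖T x‖ ≤ ‖S x - T x‖ := norm_sub_norm_le _ _
    rw [hS] at h2
    simp only [ContinuousLinearMap.comp_apply, Submodule.subtypeL_apply,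
      sub_apply, NNReal.coe_ofNat]
    change ‖(x : H)‖ ≤ _
    linarith
  have : CompleteSpace V := hVclosed.completeSpace_coe
  have hcl := hanti.isClosed_range ((S - T).comp V.subtypeL).uniformContinuous
  convert hcl using 1
  ext y
  simp

end General

/-! ### Joint densities against products of marginals. -/

section Density

variable {Ω E F : Type*} [MeasurableSpace Ω] [MeasurableSpace E] [MeasurableSpace F]
  {P : Measure Ω} {X : Ω → E} {Y : Ω → F}
  {κ : Measure E} {η : Measure F}

theorem ae_pdf_ne_zero_and_ne_top [IsProbabilityMeasure P] [HasPDF X P κ] (hX : Measurable X) :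
    ∀ᵐ ω ∂P, pdf X P κ (X ω) ≠ 0 ∧ pdf X P κ (X ω) ≠ ∞ := by
  have hac : P.map X ≪ κ := HasPDF.absolutelyContinuous
  have : (P.map X).HaveLebesgueDecomposition κ := HasPDF.haveLebesgueDecomposition
  have h1 := ae_of_ae_map hX.aemeasurable (Measure.rnDeriv_pos hac)
  have h2 := ae_of_ae_map hX.aemeasurable (hac.ae_le (pdf.ae_lt_top : ∀ᵐ x ∂κ, pdf X P κ x < ∞))
  filter_upwards [h1, h2] with ω h1 h2
  exact ⟨h1.ne', h2.ne⟩

theorem map_prod_map_eq_withDensity [SigmaFinite η] [HasPDF X P κ] [HasPDF Y P η] :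
    (P.map X).prod (P.map Y) =
      (κ.prod η).withDensity fun z => pdf X P κ z.1 * pdf Y P η z.2 := by
  rw [map_eq_withDensity_pdf X P κ, map_eq_withDensity_pdf Y P η]
  exact prod_withDensity (measurable_pdf X P κ) (measurable_pdf Y P η)

/-- A set null for the product of the marginals meets `{f_X f_Y ≠ 0}` in a reference-null set, which
`(X, Y)` avoids; and `f_X(X) f_Y(Y) ≠ 0` almost surely. -/
theorem map_prodMk_absolutelyContinuous [IsProbabilityMeasure P] [SigmaFinite η]
    [HasPDF X P κ] [HasPDF Y P η] (hX : Measurable X) (hY : Measurable Y)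
    (hac : P.map (fun ω => (X ω, Y ω)) ≪ κ.prod η) :
    P.map (fun ω => (X ω, Y ω)) ≪ (P.map X).prod (P.map Y) := by
  have hXm := measurable_pdf X P κ
  have hYm := measurable_pdf Y P η
  refine Measure.AbsolutelyContinuous.mk fun s hs h => ?_
  rw [map_prod_map_eq_withDensity (κ := κ) (η := η), withDensity_apply_eq_zero (by fun_prop)] at h
  have h1 := hac h
  rw [Measure.map_apply (hX.prodMk hY) (by measurability)] at h1
  rw [Measure.map_apply (hX.prodMk hY) hs]
  have h2 : ∀ᵐ ω ∂P, ¬ (pdf X P κ (X ω) * pdf Y P η (Y ω) ≠ 0 ∧ (X ω, Y ω) ∈ s) :=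
    measure_eq_zero_iff_ae_notMem.1 h1
  refine measure_eq_zero_iff_ae_notMem.2 ?_
  filter_upwards [h2, ae_pdf_ne_zero_and_ne_top (κ := κ) hX,
    ae_pdf_ne_zero_and_ne_top (κ := η) hY] with ω h2 h3 h4 h5
  exact h2 ⟨mul_ne_zero h3.1 h4.1, h5⟩

/-- The functional `k ↦ E[a k(X, Y)]` is bounded on the `L²` space of the product of the
marginals, when `a` is square-integrable with weight the ratio of the densities. -/
theorem lintegral_enorm_mul_le_of_pdf [IsProbabilityMeasure P] [SigmaFinite κ] [SigmaFinite η]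
    [HasPDF X P κ] [HasPDF Y P η]
    [HasPDF (fun ω => (X ω, Y ω)) P (κ.prod η)] (hX : Measurable X) (hY : Measurable Y)
    {a : Ω → ℝ} (ha : Measurable a) {k : E × F → ℝ} (hk : Measurable k) :
    ∫⁻ ω, ‖a ω * k (X ω, Y ω)‖ₑ ∂P ≤
      (∫⁻ ω, ‖a ω‖ₑ ^ 2 * (pdf X P κ (X ω))⁻¹ * (pdf Y P η (Y ω))⁻¹ *
        pdf (fun ω => (X ω, Y ω)) P (κ.prod η) (X ω, Y ω) ∂P) ^ (1 / 2 : ℝ) *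
        eLpNorm k 2 ((P.map X).prod (P.map Y)) := by
  set fX := pdf X P κ with hfX
  set fY := pdf Y P η with hfY
  set f := pdf (fun ω => (X ω, Y ω)) P (κ.prod η) with hf
  have hXm : Measurable fX := measurable_pdf X P κ
  have hYm : Measurable fY := measurable_pdf Y P η
  have hfm : Measurable f := measurable_pdf _ P _
  have hXY : Measurable fun ω => (X ω, Y ω) := hX.prodMk hY
  -- With the weight `f / (f_X f_Y)`, integrating `k²` over its inverse against the joint density
  -- `f` leaves `k² f_X f_Y`.
  have h1 := lintegral_enorm_mul_le_weighted (μ := P) (f := a) (g := fun ω => k (X ω, Y ω))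
    (ρ := fun ω => (fX (X ω))⁻¹ * (fY (Y ω))⁻¹ * f (X ω, Y ω)) ha.aemeasurable
    (hk.comp hXY).aemeasurable
    (((hXm.comp hX).inv.mul (hYm.comp hY).inv).mul (hfm.comp hXY)).aemeasurable (by
      filter_upwards [ae_pdf_ne_zero_and_ne_top (κ := κ) hX,
        ae_pdf_ne_zero_and_ne_top (κ := η) hY,
        ae_pdf_ne_zero_and_ne_top (κ := κ.prod η) hXY] with ω h1 h2 h3
      right
      exact ⟨mul_ne_zero (mul_ne_zero (ENNReal.inv_ne_zero.2 h1.2) (ENNReal.inv_ne_zero.2 h2.2))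
        h3.1, ENNReal.mul_ne_top (ENNReal.mul_ne_top (ENNReal.inv_ne_top.2 h1.1)
        (ENNReal.inv_ne_top.2 h2.1)) h3.2⟩)
  refine h1.trans ?_
  rw [eLpNorm_two_eq_lintegral_rpow]
  simp only [← mul_assoc]
  refine mul_le_mul' le_rfl (ENNReal.rpow_le_rpow ?_ (by norm_num))
  rw [map_prod_map_eq_withDensity (κ := κ) (η := η),
    lintegral_withDensity_eq_lintegral_mul₀ (by fun_prop) (by fun_prop)]
  have h2 : ∫⁻ z, f z * (‖k z‖ₑ ^ 2 * ((fX z.1)⁻¹ * (fY z.2)⁻¹ * f z)⁻¹) ∂κ.prod η = _ :=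
    pdf.lintegral_pdf_mul (f := fun z => ‖k z‖ₑ ^ 2 * ((fX z.1)⁻¹ * (fY z.2)⁻¹ * f z)⁻¹)
      (by fun_prop)
  rw [← h2]
  refine lintegral_mono_ae ?_
  have e1 : ∀ᵐ z ∂κ.prod η, fX z.1 < ∞ :=
    Measure.quasiMeasurePreserving_fst.ae (pdf.ae_lt_top : ∀ᵐ x ∂κ, pdf X P κ x < ∞)
  have e2 : ∀ᵐ z ∂κ.prod η, fY z.2 < ∞ :=
    Measure.quasiMeasurePreserving_snd.ae (pdf.ae_lt_top : ∀ᵐ y ∂η, pdf Y P η y < ∞)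
  have e3 : ∀ᵐ z ∂κ.prod η, f z < ∞ := pdf.ae_lt_top
  filter_upwards [e1, e2, e3] with z e1 e2 e3
  change f z * _ ≤ fX z.1 * fY z.2 * ‖k z‖ₑ ^ 2
  -- Where the joint density vanishes the left side is zero while the right need not be; hence only
  -- an inequality.
  by_cases h0 : f z = 0
  · simp [h0]
  · have i1 : ((fX z.1)⁻¹ * (fY z.2)⁻¹ * f z)⁻¹ = fX z.1 * fY z.2 * (f z)⁻¹ := by
      rw [ENNReal.mul_inv (Or.inr e3.ne) (Or.inr h0),
        ENNReal.mul_inv (Or.inl (ENNReal.inv_ne_zero.2 e1.ne))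
          (Or.inr (ENNReal.inv_ne_zero.2 e2.ne)), inv_inv, inv_inv]
    rw [i1]
    calc f z * (‖k z‖ₑ ^ 2 * (fX z.1 * fY z.2 * (f z)⁻¹))
        = fX z.1 * fY z.2 * ‖k z‖ₑ ^ 2 * (f z * (f z)⁻¹) := by ring
      _ = fX z.1 * fY z.2 * ‖k z‖ₑ ^ 2 := by rw [ENNReal.mul_inv_cancel h0 e3.ne, mul_one]
      _ ≤ _ := le_rfl

end Density

/-! ### The conditional expectation operator and its Hilbert-Schmidt bound. -/

section Operator

variable {Ω E F : Type*} [MeasurableSpace Ω] [MeasurableSpace E] [MeasurableSpace F]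
  {P : Measure Ω} {X : Ω → E} {Y : Ω → F} {a : Ω → ℝ} {C : ℝ≥0∞}

theorem eLpNorm_two_prod_mul {μ : Measure E} {ν : Measure F} [SFinite ν] {g : E → ℝ} {l : F → ℝ}
    (hg : Measurable g) (hl : Measurable l) :
    eLpNorm (fun z : E × F => g z.1 * l z.2) 2 (μ.prod ν) = eLpNorm g 2 μ * eLpNorm l 2 ν := by
  simp only [eLpNorm_two_eq_lintegral_rpow, enorm_mul, mul_pow]
  rw [lintegral_prod_mul (f := fun x => ‖g x‖ₑ ^ 2) (g := fun y => ‖l y‖ₑ ^ 2)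
    (by fun_prop) (by fun_prop), ENNReal.mul_rpow_of_nonneg _ _ (by norm_num)]

theorem integrable_mul_of_lintegral_le (hX : Measurable X) (hY : Measurable Y) (ha : Measurable a)
    (hC : C ≠ ∞)
    (hb : ∀ k : E × F → ℝ, Measurable k →
      ∫⁻ ω, ‖a ω * k (X ω, Y ω)‖ₑ ∂P ≤ C * eLpNorm k 2 ((P.map X).prod (P.map Y)))
    {k : E × F → ℝ} (hk : Measurable k) (hk2 : MemLp k 2 ((P.map X).prod (P.map Y))) :
    Integrable (fun ω => a ω * k (X ω, Y ω)) P :=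
  ⟨(ha.mul (hk.comp (hX.prodMk hY))).aestronglyMeasurable,
    (hb k hk).trans_lt (ENNReal.mul_lt_top hC.lt_top hk2.2)⟩

theorem integrable_mul_comp_of_lintegral_le [IsProbabilityMeasure P]
    (hX : Measurable X) (hY : Measurable Y)
    (ha : Measurable a) (hC : C ≠ ∞)
    (hb : ∀ k : E × F → ℝ, Measurable k →
      ∫⁻ ω, ‖a ω * k (X ω, Y ω)‖ₑ ∂P ≤ C * eLpNorm k 2 ((P.map X).prod (P.map Y)))
    {g : E → ℝ} (hg : Measurable g) (hg2 : MemLp g 2 (P.map X)) :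
    Integrable (fun ω => a ω * g (X ω)) P := by
  have := Measure.isProbabilityMeasure_map (μ := P) hY.aemeasurable
  exact integrable_mul_of_lintegral_le hX hY ha hC hb (k := fun z => g z.1)
    (hg.comp measurable_fst) (hg2.comp_fst _)

/-- By duality it suffices to test against functions `l(Y)`; the bound `hb` applies to `g ⊗ l`,
whose norm in the product space factors. -/
theorem eLpNorm_condExp_mul_comp_le [IsProbabilityMeasure P] (hX : Measurable X) (hY : Measurable Y)
    (ha : Measurable a) (hC : C ≠ ∞)
    (hb : ∀ k : E × F → ℝ, Measurable k →
      ∫⁻ ω, ‖a ω * k (X ω, Y ω)‖ₑ ∂P ≤ C * eLpNorm k 2 ((P.map X).prod (P.map Y)))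
    {g : E → ℝ} (hg : Measurable g) (hg2 : MemLp g 2 (P.map X)) :
    eLpNorm (P[fun ω => a ω * g (X ω) | MeasurableSpace.comap Y inferInstance]) 2 P ≤
      C * eLpNorm g 2 (P.map X) := by
  refine eLpNorm_condExp_le_of_lintegral_mul_le hY.comap_le
    (integrable_mul_comp_of_lintegral_le hX hY ha hC hb hg hg2) fun ψ hψ => ?_
  obtain ⟨l, hl, rfl⟩ := hψ.exists_eq_measurable_comp
  have h1 := hb (fun z => g z.1 * l z.2) (by fun_prop)
  have := Measure.isProbabilityMeasure_map (μ := P) hY.aemeasurable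
  rw [eLpNorm_two_prod_mul hg hl, eLpNorm_map_measure hl.aestronglyMeasurable hY.aemeasurable,
    ← mul_assoc] at h1
  simpa [mul_assoc] using h1

/-- The operator `g ↦ E[a g(X) | Y]`. -/
theorem exists_condExp_operator [IsProbabilityMeasure P] (hX : Measurable X) (hY : Measurable Y)
    (ha : Measurable a) (hC : C ≠ ∞)
    (hb : ∀ k : E × F → ℝ, Measurable k →
      ∫⁻ ω, ‖a ω * k (X ω, Y ω)‖ₑ ∂P ≤ C * eLpNorm k 2 ((P.map X).prod (P.map Y))) :
    ∃ T : Lp ℝ 2 (P.map X) →L[ℝ] Lp ℝ 2 P, ∀ g : Lp ℝ 2 (P.map X),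
      T g =ᵐ[P] P[fun ω => a ω * g (X ω) | MeasurableSpace.comap Y inferInstance] := by
  have hint : ∀ g : Lp ℝ 2 (P.map X), Integrable (fun ω => a ω * g (X ω)) P := fun g =>
    integrable_mul_comp_of_lintegral_le hX hY ha hC hb (Lp.stronglyMeasurable g).measurable
      (Lp.memLp g)
  have hle : ∀ g : Lp ℝ 2 (P.map X),
      eLpNorm (P[fun ω => a ω * g (X ω) | MeasurableSpace.comap Y inferInstance]) 2 P ≤
      C * eLpNorm g 2 (P.map X) := fun g =>
    eLpNorm_condExp_mul_comp_le hX hY ha hC hb (Lp.stronglyMeasurable g).measurable (Lp.memLp g)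
  have hmem : ∀ g : Lp ℝ 2 (P.map X),
      MemLp (P[fun ω => a ω * g (X ω) | MeasurableSpace.comap Y inferInstance]) 2 P := fun g =>
    ⟨integrable_condExp.1, (hle g).trans_lt (ENNReal.mul_lt_top hC.lt_top (Lp.memLp g).2)⟩
  let T₀ : Lp ℝ 2 (P.map X) →ₗ[ℝ] Lp ℝ 2 P :=
    { toFun := fun g => (hmem g).toLp _
      map_add' := by
        intro g g'
        rw [← MemLp.toLp_add, MemLp.toLp_eq_toLp_iff]
        refine Filter.EventuallyEq.trans (condExp_congr_ae ?_) (condExp_add (hint g) (hint g') _)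
        filter_upwards [ae_of_ae_map hX.aemeasurable (Lp.coeFn_add g g')] with ω hω
        simp only [Pi.add_apply] at hω ⊢
        rw [hω, mul_add]
      map_smul' := by
        intro c g
        rw [RingHom.id_apply, ← MemLp.toLp_const_smul, MemLp.toLp_eq_toLp_iff]
        refine Filter.EventuallyEq.trans (condExp_congr_ae ?_)
          (condExp_smul c (fun ω => a ω * g (X ω)) _)
        filter_upwards [ae_of_ae_map hX.aemeasurable (Lp.coeFn_smul c g)] with ω hω
        simp only [Pi.smul_apply, smul_eq_mul] at hω ⊢
        rw [hω, mul_left_comm] }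
  refine ⟨T₀.mkContinuous C.toReal fun g => ?_, fun g => (hmem g).coeFn_toLp⟩
  change ‖(hmem g).toLp _‖ ≤ _
  rw [Lp.norm_toLp, Lp.norm_def, ← ENNReal.toReal_mul]
  exact ENNReal.toReal_mono (ENNReal.mul_ne_top hC (Lp.memLp g).2.ne) (hle g)

/-- No kernel is constructed. Write `T e_i = l_i(Y)` and test the functional on `k = ∑ e_i ⊗ l_i`
over a finite set: its value and `‖k‖²` both equal `N = ∑ ‖T e_i‖²`, so `N ≤ C √N`, that is `N ≤
C²`. -/
theorem summable_norm_sq_condExp_operator [IsProbabilityMeasure P]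
    (hX : Measurable X) (hY : Measurable Y)
    (ha : Measurable a) (hC : C ≠ ∞)
    (hb : ∀ k : E × F → ℝ, Measurable k →
      ∫⁻ ω, ‖a ω * k (X ω, Y ω)‖ₑ ∂P ≤ C * eLpNorm k 2 ((P.map X).prod (P.map Y)))
    (T : Lp ℝ 2 (P.map X) →L[ℝ] Lp ℝ 2 P)
    (hT : ∀ g : Lp ℝ 2 (P.map X),
      T g =ᵐ[P] P[fun ω => a ω * g (X ω) | MeasurableSpace.comap Y inferInstance])
    {ι : Type*} {e : ι → Lp ℝ 2 (P.map X)} (he : Orthonormal ℝ e) :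
    Summable fun i => ‖T (e i)‖ ^ 2 := by
  classical
  have : IsProbabilityMeasure (P.map X) := Measure.isProbabilityMeasure_map hX.aemeasurable
  have : IsProbabilityMeasure (P.map Y) := Measure.isProbabilityMeasure_map hY.aemeasurable
  have hem : ∀ i, Measurable (e i) := fun i => (Lp.stronglyMeasurable (e i)).measurable
  have hint : ∀ i, Integrable (fun ω => a ω * e i (X ω)) P := fun i =>
    integrable_mul_comp_of_lintegral_le hX hY ha hC hb (hem i) (Lp.memLp _)
  have hl : ∀ i, ∃ l : F → ℝ, Measurable l ∧ T (e i) =ᵐ[P] l ∘ Y := fun i => by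
    obtain ⟨l, hl, h⟩ := (stronglyMeasurable_condExp (μ := P) (f := fun ω => a ω * e i (X ω))
      (m := MeasurableSpace.comap Y inferInstance)).measurable.exists_eq_measurable_comp
    exact ⟨l, hl, h ▸ hT (e i)⟩
  choose l hlm hle using hl
  have hl2 : ∀ i, MemLp (l i) 2 (P.map Y) := fun i => by
    have : MemLp (l i ∘ Y) 2 P := (memLp_congr_ae (hle i)).1 (Lp.memLp (T (e i)))
    exact (memLp_map_measure_iff (hlm i).aestronglyMeasurable hY.aemeasurable).2 this
  have hprod : ∀ i, MemLp (fun z : E × F => e i z.1 * l i z.2) 2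
      ((P.map X).prod (P.map Y)) := fun i =>
    ⟨(((hem i).comp measurable_fst).mul ((hlm i).comp measurable_snd)).aestronglyMeasurable, by
      rw [eLpNorm_two_prod_mul (hem i) (hlm i)]
      exact ENNReal.mul_lt_top (Lp.memLp (e i)).2 (hl2 i).2⟩
  have hnorm : ∀ i, ‖T (e i)‖ ^ 2 = ∫ y, l i y ^ 2 ∂P.map Y := fun i => by
    rw [← real_inner_self_eq_norm_sq, L2.inner_def,
      integral_map hY.aemeasurable ((hlm i).pow_const 2).aestronglyMeasurable]
    refine integral_congr_ae ?_
    filter_upwards [hle i] with ω hω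
    simp only [hω, Function.comp_apply, RCLike.inner_apply, conj_trivial, sq]
  have horth : ∀ i j, ∫ x, e i x * e j x ∂P.map X = if i = j then 1 else 0 := fun i j => by
    rw [← orthonormal_iff_ite.1 he i j, L2.inner_def]
    refine integral_congr_ae (ae_of_all _ fun x => ?_)
    simp [mul_comm]
  have hterm : ∀ i, ∫ ω, a ω * (e i (X ω) * l i (Y ω)) ∂P = ∫ y, l i y ^ 2 ∂P.map Y := fun i => by
    have h1 := integrable_mul_of_lintegral_le hX hY ha hC hb (k := fun z => e i z.1 * l i z.2)
      (((hem i).comp measurable_fst).mul ((hlm i).comp measurable_snd)) (hprod i)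
    simp only [← mul_assoc] at h1 ⊢
    have hpull : P[fun ω => a ω * e i (X ω) * l i (Y ω) |
        MeasurableSpace.comap Y inferInstance] =ᵐ[P] _ :=
      condExp_mul_of_stronglyMeasurable_right
        ((hlm i).comp (comap_measurable Y)).stronglyMeasurable h1 (hint i)
    rw [← integral_condExp hY.comap_le (f := fun ω => a ω * e i (X ω) * l i (Y ω)),
      integral_congr_ae hpull,
      integral_map hY.aemeasurable ((hlm i).pow_const 2).aestronglyMeasurable]
    refine integral_congr_ae ?_
    filter_upwards [hle i, hT (e i)] with ω h1 h2
    rw [Pi.mul_apply, ← h2, h1, Function.comp_apply, sq]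
  refine summable_of_sum_le (c := C.toReal ^ 2) (fun i => sq_nonneg _) fun s => ?_
  set k : E × F → ℝ := fun z => ∑ i ∈ s, e i z.1 * l i z.2 with hk
  have hkm : Measurable k := Finset.measurable_fun_sum s fun i _ =>
    ((hem i).comp measurable_fst).mul ((hlm i).comp measurable_snd)
  have hk2 : MemLp k 2 ((P.map X).prod (P.map Y)) := memLp_finsetSum s fun i _ => hprod i
  have hksq : ∫ z, k z ^ 2 ∂(P.map X).prod (P.map Y) = ∑ i ∈ s, ∫ y, l i y ^ 2 ∂P.map Y := by
    have h1 : ∀ z, k z ^ 2 = ∑ i ∈ s, ∑ j ∈ s, (e i z.1 * e j z.1) * (l i z.2 * l j z.2) := by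
      intro z
      rw [hk, sq, Finset.sum_mul_sum]
      exact Finset.sum_congr rfl fun i _ => Finset.sum_congr rfl fun j _ => by ring
    have hi : ∀ i j, Integrable (fun z : E × F => (e i z.1 * e j z.1) * (l i z.2 * l j z.2))
        ((P.map X).prod (P.map Y)) := fun i j =>
      ((Lp.memLp (e i)).integrable_mul (Lp.memLp (e j))).mul_prod
        ((hl2 i).integrable_mul (hl2 j))
    simp only [h1]
    rw [integral_finsetSum _ fun i _ => integrable_finsetSum _ fun j _ => hi i j]
    refine Finset.sum_congr rfl fun i his => ?_
    rw [integral_finsetSum _ fun j _ => hi i j]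
    have h2 : ∀ j, ∫ z, (e i z.1 * e j z.1) * (l i z.2 * l j z.2) ∂(P.map X).prod (P.map Y) =
        if i = j then ∫ y, l i y ^ 2 ∂P.map Y else 0 := fun j => by
      rw [integral_prod_mul (fun x => e i x * e j x) (fun y => l i y * l j y), horth]
      split_ifs with h
      · subst h
        simp [sq]
      · simp
    simp [h2, his]
  have hsum : ∫ ω, a ω * k (X ω, Y ω) ∂P = ∑ i ∈ s, ∫ y, l i y ^ 2 ∂P.map Y := by
    simp only [hk, Finset.mul_sum]
    rw [integral_finsetSum]
    · exact Finset.sum_congr rfl fun i _ => hterm i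
    · intro i _
      exact integrable_mul_of_lintegral_le hX hY ha hC hb (k := fun z => e i z.1 * l i z.2)
        (((hem i).comp measurable_fst).mul ((hlm i).comp measurable_snd)) (hprod i)
  simp only [hnorm]
  set N := ∑ i ∈ s, ∫ y, l i y ^ 2 ∂P.map Y with hN
  have hN0 : 0 ≤ N := Finset.sum_nonneg fun i _ => integral_nonneg fun y => sq_nonneg _
  have hkN : eLpNorm k 2 ((P.map X).prod (P.map Y)) = ENNReal.ofReal (Real.sqrt N) := by
    rw [eLpNorm_two_eq_lintegral_rpow, lintegral_enorm_sq_eq_ofReal_integral hk2, hksq,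
      ENNReal.ofReal_rpow_of_nonneg hN0 (by norm_num), Real.sqrt_eq_rpow]
  have hle : N ≤ C.toReal * Real.sqrt N := by
    have h1 := (enorm_integral_le_lintegral_enorm (μ := P) fun ω => a ω * k (X ω, Y ω)).trans
      (hb k hkm)
    rw [hsum, hkN, Real.enorm_eq_ofReal hN0] at h1
    have h2 := ENNReal.toReal_mono (ENNReal.mul_ne_top hC ENNReal.ofReal_ne_top) h1
    rwa [ENNReal.toReal_ofReal hN0, ENNReal.toReal_mul,
      ENNReal.toReal_ofReal (Real.sqrt_nonneg _)] at h2
  have hC0 : 0 ≤ C.toReal := ENNReal.toReal_nonneg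
  have hsq := Real.sq_sqrt hN0
  have hs0 := Real.sqrt_nonneg N
  have hsC : Real.sqrt N ≤ C.toReal := by
    rcases hs0.eq_or_lt with h | h
    · exact h ▸ hC0
    · nlinarith
  nlinarith

end Operator

/-! ### Functional identities between two dependent variables. -/

section Rigidity

variable {Ω E F : Type*} [MeasurableSpace Ω] [MeasurableSpace E] [MeasurableSpace F]
  {P : Measure Ω} [IsProbabilityMeasure P]

/-- If the joint law of `(X, Y)` is absolutely continuous with respect to the product of the
marginals and `u(X) = v(Y)`, then `u(X)` takes countably many values. -/
theorem exists_countable_ae_mem_of_ae_eq {X : Ω → E} {Y : Ω → F} (hX : Measurable X)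
    (hY : Measurable Y)
    (hac : P.map (fun ω => (X ω, Y ω)) ≪ (P.map X).prod (P.map Y))
    {u : E → ℝ} {v : F → ℝ} (hu : Measurable u) (hv : Measurable v)
    (h : ∀ᵐ ω ∂P, u (X ω) = v (Y ω)) :
    ∃ S : Set ℝ, S.Countable ∧ ∀ᵐ ω ∂P, u (X ω) ∈ S := by
  -- The atoms of the law of `u(X)`.
  set S : Set ℝ := {r | 0 < P.map X (u ⁻¹' {r})} with hS
  have := Measure.isProbabilityMeasure_map (μ := P) hX.aemeasurable
  have := Measure.isProbabilityMeasure_map (μ := P) hY.aemeasurable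
  have hSc : S.Countable := Measure.countable_meas_pos_of_disjoint_iUnion
    (fun r => hu (measurableSet_singleton r)) fun r s hrs =>
      Disjoint.preimage u (Set.disjoint_singleton.2 hrs)
  refine ⟨S, hSc, ?_⟩
  have hN : MeasurableSet {z : E × F | u z.1 = v z.2 ∧ v z.2 ∉ S} :=
    (measurableSet_eq_fun (hu.comp measurable_fst) (hv.comp measurable_snd)).inter
      ((hv.comp measurable_snd) hSc.measurableSet.compl)
  -- Fubini: if `v y` is not an atom, the section `{x | u x = v y}` is null; otherwise the section
  -- is empty.
  have hN0 : (P.map X).prod (P.map Y) {z : E × F | u z.1 = v z.2 ∧ v z.2 ∉ S} = 0 := by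
    rw [Measure.prod_apply_symm hN, ← lintegral_zero (μ := P.map Y)]
    refine lintegral_congr fun y => ?_
    by_cases hy : v y ∈ S
    · simp [hy]
    · have h1 : P.map X (u ⁻¹' {v y}) = 0 := by
        simpa [hS] using hy
      exact measure_mono_null (fun x hx => hx.1) h1
  have h2 := hac hN0
  rw [Measure.map_apply (hX.prodMk hY) hN] at h2
  filter_upwards [h, measure_eq_zero_iff_ae_notMem.1 h2] with ω h1 h2
  by_contra h3
  exact h2 ⟨h1, h1 ▸ h3⟩

/-- The difference of two identically distributed variables can be constant only if it is zero. -/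
theorem eq_zero_of_map_eq_of_ae_eq_add {U V : Ω → ℝ} (hU : Measurable U) (hV : Measurable V)
    (hUV : P.map U = P.map V) {r : ℝ} (h : ∀ᵐ ω ∂P, U ω = V ω + r) : r = 0 := by
  -- `U` and `V` may have no mean; `arctan` is bounded and strictly increasing, so means can be
  -- compared after applying it.
  have hint : ∀ {f : Ω → ℝ}, Measurable f → Integrable (fun ω => Real.arctan (f ω)) P :=
    fun hf => Integrable.of_bound (Real.continuous_arctan.measurable.comp hf).aestronglyMeasurable
      (Real.pi / 2) (ae_of_all _ fun ω => abs_le.2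
        ⟨(Real.neg_pi_div_two_lt_arctan _).le, (Real.arctan_lt_pi_div_two _).le⟩)
  have h1 : ∫ ω, Real.arctan (U ω) ∂P = ∫ ω, Real.arctan (V ω) ∂P := by
    rw [← integral_map (φ := U) hU.aemeasurable Real.continuous_arctan.aestronglyMeasurable,
      ← integral_map (φ := V) hV.aemeasurable Real.continuous_arctan.aestronglyMeasurable, hUV]
  have hmono : ∀ x : ℝ, 0 ≤ r * (Real.arctan (x + r) - Real.arctan x) := by
    intro x
    rcases le_total 0 r with hr | hr
    · exact mul_nonneg hr (sub_nonneg.2 (Real.arctan_mono (by linarith)))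
    · exact mul_nonneg_of_nonpos_of_nonpos hr (sub_nonpos.2 (Real.arctan_mono (by linarith)))
  have h2 : ∫ ω, r * (Real.arctan (U ω) - Real.arctan (V ω)) ∂P = 0 := by
    rw [integral_const_mul, integral_sub (hint hU) (hint hV), h1, sub_self, mul_zero]
  have h3 := (integral_eq_zero_iff_of_nonneg_ae (by
    filter_upwards [h] with ω hω
    simp only [Pi.zero_apply, Pi.sub_apply, hω]
    exact hmono _) (((hint hU).sub (hint hV)).const_mul r)).1 h2
  obtain ⟨ω, hω, hω'⟩ := (h.and h3).exists
  by_contra hr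
  simp only [Pi.zero_apply, Pi.sub_apply, mul_eq_zero, hr, false_or, hω, sub_eq_zero] at hω'
  exact hr (by simpa using Real.arctan_injective hω')

/-- An affine function of `log X` is an increment `G(X) - G(Y)` only if it vanishes. -/
theorem affine_log_eq_zero_of_eq_increment {X Y : Ω → ℝ} (hX : Measurable X) (hY : Measurable Y)
    (hXY : P.map X = P.map Y) (hX0 : ∀ᵐ ω ∂P, 0 < X ω) (hvol : P.map X ≪ volume)
    (hac : P.map (fun ω => (X ω, Y ω)) ≪ (P.map X).prod (P.map Y))
    {G : ℝ → ℝ} (hG : Measurable G) {r s : ℝ}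
    (h : ∀ᵐ ω ∂P, r - s * Real.log (X ω) = G (X ω) - G (Y ω)) : r = 0 ∧ s = 0 := by
  have hs : s = 0 := by
    by_contra hs
    obtain ⟨S, hS, hSX⟩ := exists_countable_ae_mem_of_ae_eq hX hY hac
      (u := fun x => G x + s * Real.log x) (v := fun y => G y + r)
      (hG.add (Real.measurable_log.const_mul s)) (hG.add_const r)
      (h.mono fun ω hω => by linarith)
    -- The identity confines `G(Y)` to a countable set; equality of laws transfers this to `G(X)`.
    have hSY : ∀ᵐ ω ∂P, G (X ω) ∈ (fun a => a - r) '' S := by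
      have h1 : ∀ᵐ ω ∂P, G (Y ω) ∈ (fun a => a - r) '' S := by
        filter_upwards [h, hSX] with ω h1 h2
        exact ⟨_, h2, by simp only; linarith⟩
      have hm : MeasurableSet (G ⁻¹' ((fun a => a - r) '' S)) :=
        hG (hS.image _).measurableSet
      have h2 : ∀ᵐ y ∂P.map Y, G y ∈ (fun a => a - r) '' S :=
        (ae_map_iff hY.aemeasurable hm).2 h1
      rw [← hXY] at h2
      exact ae_of_ae_map hX.aemeasurable h2
    -- `X` is recovered from the two countably-valued quantities `G(X) + s log X` and `G(X)`.
    set K : Set ℝ := (fun p : ℝ × ℝ => Real.exp ((p.1 - p.2) / s)) '' (S ×ˢ ((fun a => a - r) '' S))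
      with hK
    have hKc : K.Countable := (hS.prod (hS.image _)).image _
    have hmem : ∀ᵐ ω ∂P, X ω ∈ K := by
      filter_upwards [hSX, hSY, hX0] with ω h1 h2 h3
      refine ⟨(G (X ω) + s * Real.log (X ω), G (X ω)), ⟨h1, h2⟩, ?_⟩
      simp only [add_sub_cancel_left, mul_div_cancel_left₀ _ hs, Real.exp_log h3]
    have hnull : P (X ⁻¹' K) = 0 := by
      rw [← Measure.map_apply hX hKc.measurableSet]
      exact hvol (hKc.measure_zero _)
    obtain ⟨ω, h1, h2⟩ := (hmem.and (measure_eq_zero_iff_ae_notMem.1 hnull)).exists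
    exact h2 h1
  refine ⟨?_, hs⟩
  subst hs
  refine eq_zero_of_map_eq_of_ae_eq_add (hG.comp hX) (hG.comp hY) ?_
    (h.mono fun ω hω => ?_)
  · rw [← Measure.map_map hG hX, ← Measure.map_map hG hY, hXY]
  · simp only [Function.comp_apply]
    linarith

end Rigidity

/-! ### Stationarity and moment bounds in the model. -/

namespace CCAPM

variable {Ω : Type*} [MeasurableSpace Ω] {P : Measure Ω} {J q k : ℕ}

theorem measurable_W (M : CCAPM P J q) (t : ℤ) : Measurable (M.W t) :=
  (M.measurable_Z t).prodMk (M.measurable_c t)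

theorem measurable_Wtilde (M : CCAPM P J q) {w : (Fin q → ℝ) → (Fin k → ℝ)} (hw : Measurable w)
    (t : ℤ) : Measurable (M.Wtilde w t) :=
  (hw.comp (M.measurable_Z t)).prodMk (M.measurable_c t)

theorem sigmaWtilde_le_sigmaW (M : CCAPM P J q) {w : (Fin q → ℝ) → (Fin k → ℝ)}
    (hw : Measurable w) (t : ℤ) : M.sigmaWtilde w t ≤ M.sigmaW t := by
  have h : M.Wtilde w t = (fun p : (Fin q → ℝ) × ℝ => (w p.1, p.2)) ∘ M.W t := rfl
  rw [sigmaWtilde, h, ← MeasurableSpace.comap_comp]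
  refine MeasurableSpace.comap_mono (Measurable.comap_le ?_)
  exact (hw.comp measurable_fst).prodMk measurable_snd

theorem measurable_A (M : CCAPM P J q) (t : ℤ) (i : Fin J) : Measurable (M.A t i) := by
  have h1 := M.measurable_R (t + 1)
  have h2 := M.measurable_c (t + 1)
  have h3 : Measurable fun ω => M.R (t + 1) ω i :=
    (EuclideanSpace.proj (𝕜 := ℝ) i).continuous.measurable.comp h1
  exact (h3.const_mul _).mul (h2.pow_const _)

theorem measurable_X (M : CCAPM P J q) (t : ℤ) (l : Fin 2) : Measurable (M.X t l) := by
  have h2 := M.measurable_c (t + 1)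
  fin_cases l
  · exact measurable_const
  · exact (Real.measurable_log.comp h2).neg

theorem map_c_succ_eq (M : CCAPM P J q) {Δ : ℝ} {t : ℤ} (h : M.Regular Δ t) :
    P.map (M.c (t + 1)) = P.map (M.c t) := by
  have hm : ∀ s, Measurable fun ω => (M.R s ω, M.c s ω, M.W s ω) := fun s =>
    (M.measurable_R s).prodMk ((M.measurable_c s).prodMk (M.measurable_W s))
  have h1 := congrArg (Measure.map fun x : ℤ → EuclideanSpace ℝ (Fin J) × ℝ × (Fin q → ℝ) × ℝ =>
    (x t).2.1) (h.stationary 1)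
  have hp : Measurable fun x : ℤ → EuclideanSpace ℝ (Fin J) × ℝ × (Fin q → ℝ) × ℝ =>
      (x t).2.1 := (measurable_pi_apply t).snd.fst
  rwa [Measure.map_map hp (measurable_pi_lambda _ fun s => hm (s + 1)),
    Measure.map_map hp (measurable_pi_lambda _ hm)] at h1

theorem rpow_le_iSup (M : CCAPM P J q) {Δ : ℝ} (hΔ : 0 < Δ) {x : ℝ} (hx : 0 < x) :
    x ^ (-M.γ₀) ≤ ⨆ γ : Set.Icc (M.γ₀ - Δ) (M.γ₀ + Δ), x ^ (-(γ : ℝ)) := by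
  have hbdd : BddAbove (Set.range fun γ : Set.Icc (M.γ₀ - Δ) (M.γ₀ + Δ) => x ^ (-(γ : ℝ))) :=
    (isCompact_range ((Real.continuous_const_rpow hx.ne').comp
      continuous_subtype_val.neg)).bddAbove
  exact le_ciSup hbdd ⟨M.γ₀, by constructor <;> linarith⟩

theorem abs_A_mul_le (M : CCAPM P J q) {Δ : ℝ} (hΔ : 0 < Δ) (t : ℤ) (i : Fin J) {ω : Ω}
    (hc : 0 < M.c (t + 1) ω) {y : ℝ}
    (hy : M.δ₀ * |y| ≤ 2 + |Real.log (M.c (t + 1) ω)| ^ 2) :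
    |M.A t i ω * y| ≤ M.D Δ t ω := by
  have h1 : |M.R (t + 1) ω i| ≤ 1 + ‖M.R (t + 1) ω‖ := by
    have := PiLp.norm_apply_le (M.R (t + 1) ω) i
    rw [Real.norm_eq_abs] at this
    linarith
  have h2 := M.rpow_le_iSup hΔ hc
  have h3 : 0 ≤ M.c (t + 1) ω ^ (-M.γ₀) := Real.rpow_nonneg hc.le _
  have h4 : |M.A t i ω * y| =
      |M.R (t + 1) ω i| * (M.δ₀ * |y|) * M.c (t + 1) ω ^ (-M.γ₀) := by
    rw [A, disc, abs_mul, abs_mul, abs_mul, abs_of_pos M.δ₀_pos, abs_of_nonneg h3]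
    ring
  rw [h4, D]
  have h5 : 0 ≤ M.δ₀ * |y| := mul_nonneg M.δ₀_pos.le (abs_nonneg y)
  exact mul_le_mul (mul_le_mul h1 hy h5 (by positivity)) h2 h3 (by positivity)

/-- The factor `y` serves both for `1` (giving `m'_g`) and for the components of `X` (giving
`m'_β`). The `δ₀` in `A` offsets the entry `1/δ₀`, and `2 + |log c'|²` in `D` dominates the
logarithm. -/
theorem integrable_and_memLp_of_memG [IsProbabilityMeasure P] (M : CCAPM P J q) {Δ : ℝ} {t : ℤ}
    (hreg : M.Regular Δ t) (hΔ : 0 < Δ) (i : Fin J) {g : ℝ → ℝ} (hg : M.MemG Δ t g)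
    {y : Ω → ℝ} (hy : Measurable y)
    (hyb : ∀ᵐ ω ∂P, M.δ₀ * |y ω| ≤ 2 + |Real.log (M.c (t + 1) ω)| ^ 2) :
    Integrable (fun ω => M.A t i ω * y ω * g (M.c (t + 1) ω)) P ∧
      MemLp (P[fun ω => M.A t i ω * y ω * g (M.c (t + 1) ω) | M.sigmaW t]) 2 P := by
  refine integrable_mul_and_memLp_condExp (M.measurable_W t).comap_le
    ((M.measurable_A t i).mul hy).aestronglyMeasurable
    (hg.1.comp (M.measurable_c (t + 1))).aestronglyMeasurable (d := M.D Δ t) ?_ hreg.D_sq ?_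
  · filter_upwards [M.c_pos (t + 1), hyb] with ω h1 h2
    exact M.abs_A_mul_le hΔ t i h1 h2
  · have h := hg.2
    rw [gNorm, ENNReal.rpow_lt_top_iff_of_pos (by norm_num)] at h
    exact h

theorem integrable_and_memLp_A_mul [IsProbabilityMeasure P] (M : CCAPM P J q) {Δ : ℝ} {t : ℤ}
    (hreg : M.Regular Δ t) (hΔ : 0 < Δ) (i : Fin J) {g : ℝ → ℝ} (hg : M.MemG Δ t g) :
    Integrable (fun ω => M.A t i ω * g (M.c (t + 1) ω)) P ∧
      MemLp (P[fun ω => M.A t i ω * g (M.c (t + 1) ω) | M.sigmaW t]) 2 P := by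
  have h := M.integrable_and_memLp_of_memG hreg hΔ i hg (y := fun _ => 1) measurable_const
    (ae_of_all _ fun ω => by
      have := M.δ₀_lt_one
      rw [abs_one, mul_one]
      nlinarith [sq_nonneg |Real.log (M.c (t + 1) ω)|])
  simpa only [mul_one] using h

theorem integrable_and_memLp_A_mul_g₀_mul_X [IsProbabilityMeasure P] (M : CCAPM P J q) {Δ : ℝ}
    {t : ℤ} (hreg : M.Regular Δ t) (hΔ : 0 < Δ) (i : Fin J) (l : Fin 2) :
    Integrable (fun ω => M.A t i ω * M.g₀ (M.c (t + 1) ω) * M.X t l ω) P ∧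
      MemLp (P[fun ω => M.A t i ω * M.g₀ (M.c (t + 1) ω) * M.X t l ω | M.sigmaW t]) 2 P := by
  simp only [mul_right_comm _ (M.g₀ _)]
  refine M.integrable_and_memLp_of_memG hreg hΔ i hreg.g₀_mem (M.measurable_X t l)
    (ae_of_all _ fun ω => ?_)
  have h1 := M.δ₀_lt_one
  have h0 := M.δ₀_pos
  fin_cases l
  · have : |M.X t 0 ω| = 1 / M.δ₀ := by
      simp [X, abs_of_pos h0]
    change M.δ₀ * |M.X t 0 ω| ≤ _
    rw [this, mul_one_div_cancel h0.ne']
    nlinarith [sq_nonneg |Real.log (M.c (t + 1) ω)|]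
  · have : |M.X t 1 ω| = |Real.log (M.c (t + 1) ω)| := by
      simp [X]
    change M.δ₀ * |M.X t 1 ω| ≤ _
    rw [this]
    have h2 := abs_nonneg (Real.log (M.c (t + 1) ω))
    nlinarith [sq_nonneg (|Real.log (M.c (t + 1) ω)| - 1), mul_nonneg (sub_nonneg.2 h1.le) h2]

theorem memLp_mBeta [IsProbabilityMeasure P] (M : CCAPM P J q) {Δ : ℝ} {t : ℤ}
    (hreg : M.Regular Δ t) (hΔ : 0 < Δ) (l : Fin 2) : MemLp (M.mBeta t l) 2 P :=
  MemLp.of_eval_piLp fun i => (M.integrable_and_memLp_A_mul_g₀_mul_X hreg hΔ i l).2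

end CCAPM

/-! ### Nonsingularity of `Π` and uniqueness up to scale. -/

namespace CCAPM

variable {Ω : Type*} [MeasurableSpace Ω] {P : Measure Ω} {J q k : ℕ}

theorem hasPDF_marginals [IsProbabilityMeasure P] (M : CCAPM P J q)
    (w : (Fin q → ℝ) → (Fin k → ℝ)) (t : ℤ)
    (hpdf : HasPDF (fun ω => (M.c (t + 1) ω, M.Wtilde w t ω)) P volume) :
    HasPDF (M.c (t + 1)) P volume ∧ HasPDF (M.Wtilde w t) P volume :=
  ⟨pdf.quasiMeasurePreserving_hasPDF' (fun ω => (M.c (t + 1) ω, M.Wtilde w t ω))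
      (Measure.quasiMeasurePreserving_fst (μ := (volume : Measure ℝ))
        (ν := (volume : Measure ((Fin k → ℝ) × ℝ)))),
    pdf.quasiMeasurePreserving_hasPDF' (fun ω => (M.c (t + 1) ω, M.Wtilde w t ω))
      (Measure.quasiMeasurePreserving_snd (μ := (volume : Measure ℝ))
        (ν := (volume : Measure ((Fin k → ℝ) × ℝ))))⟩

theorem map_c_c_absolutelyContinuous [IsProbabilityMeasure P] (M : CCAPM P J q)
    {w : (Fin q → ℝ) → (Fin k → ℝ)} (hw : Measurable w) (t : ℤ)
    (hpdf : HasPDF (fun ω => (M.c (t + 1) ω, M.Wtilde w t ω)) P volume) :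
    P.map (fun ω => (M.c (t + 1) ω, M.c t ω)) ≪
      (P.map (M.c (t + 1))).prod (P.map (M.c t)) := by
  obtain ⟨h1, h2⟩ := M.hasPDF_marginals w t hpdf
  have hc := M.measurable_c (t + 1)
  have hW := M.measurable_Wtilde hw t
  have h3 := map_prodMk_absolutelyContinuous (P := P) (κ := volume) (η := volume) hc hW
    hpdf.absolutelyContinuous
  -- Forgetting `w(Z_t)` preserves absolute continuity and sends the product of marginals to the
  -- product of marginals.
  have h4 := h3.map (f := Prod.map id (Prod.snd : (Fin k → ℝ) × ℝ → ℝ))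
    (measurable_id.prodMap measurable_snd)
  rw [Measure.map_map (measurable_id.prodMap measurable_snd) (hc.prodMk hW),
    ← Measure.map_prod_map _ _ measurable_id measurable_snd, Measure.map_id,
    Measure.map_map measurable_snd hW] at h4
  exact h4

/-- The functional bound that follows from the Hilbert-Schmidt condition. -/
theorem HilbertSchmidt.exists_bound [IsProbabilityMeasure P] {M : CCAPM P J q}
    {w : (Fin q → ℝ) → (Fin k → ℝ)} (hw : Measurable w) {t : ℤ}
    (hpdf : HasPDF (fun ω => (M.c (t + 1) ω, M.Wtilde w t ω)) P volume) {j : Fin J}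
    (hHS : M.HilbertSchmidt w t j) :
    ∃ C : ℝ≥0∞, C ≠ ∞ ∧ ∀ h : ℝ × ((Fin k → ℝ) × ℝ) → ℝ, Measurable h →
      ∫⁻ ω, ‖M.A t j ω * h (M.c (t + 1) ω, M.Wtilde w t ω)‖ₑ ∂P ≤
        C * eLpNorm h 2 ((P.map (M.c (t + 1))).prod (P.map (M.Wtilde w t))) := by
  obtain ⟨h1, h2⟩ := M.hasPDF_marginals w t hpdf
  refine ⟨_, ENNReal.rpow_ne_top_of_nonneg (y := 1 / 2) (by norm_num) hHS.ne, fun h hh => ?_⟩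
  have : HasPDF (fun ω => (M.c (t + 1) ω, M.Wtilde w t ω)) P
    ((volume : Measure ℝ).prod (volume : Measure ((Fin k → ℝ) × ℝ))) := hpdf
  exact lintegral_enorm_mul_le_of_pdf (κ := volume) (η := volume) (M.measurable_c (t + 1))
    (M.measurable_Wtilde hw t) (M.measurable_A t j) hh

theorem mBetaL2_coeFn [IsProbabilityMeasure P] (M : CCAPM P J q) {Δ : ℝ} {t : ℤ}
    (hreg : M.Regular Δ t) (hΔ : 0 < Δ) (l : Fin 2) : M.mBetaL2 t l =ᵐ[P] M.mBeta t l := by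
  have h := M.memLp_mBeta hreg hΔ l
  rw [mBetaL2, dif_pos h]
  exact h.coeFn_toLp

/-- A singular `Π` yields a nonzero combination of the columns of `m'_β` in the closed span of
the nonparametric directions. -/
theorem exists_sum_smul_mem_tangent_of_det_eq_zero (M : CCAPM P J q) {Δ : ℝ} {t : ℤ}
    (h : (M.PiMatrix Δ t).det = 0) :
    ∃ b : Fin 2 → ℝ, b ≠ 0 ∧ ∑ l, b l • M.mBetaL2 t l ∈ M.tangent Δ t := by
  have : CompleteSpace (M.tangent Δ t) :=
    (Submodule.isClosed_topologicalClosure _).completeSpace_coe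
  obtain ⟨b, hb, hb0⟩ := Matrix.exists_mulVec_eq_zero_iff.2 h
  refine ⟨b, hb, ?_⟩
  have hPi : ∀ l l', M.PiMatrix Δ t l l' = inner ℝ (M.resid Δ t l) (M.resid Δ t l') :=
    fun l l' => rfl
  -- The squared norm of this combination is `bᵀ Π b = 0`.
  have hz : ∑ l, b l • M.resid Δ t l = 0 := by
    rw [← inner_self_eq_zero (𝕜 := ℝ), sum_inner]
    refine Finset.sum_eq_zero fun l _ => ?_
    have h1 := congrFun hb0 l
    simp only [Matrix.mulVec, dotProduct, Pi.zero_apply] at h1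
    rw [inner_smul_left, inner_sum]
    simp only [inner_smul_right, ← hPi, mul_comm (b _)]
    rw [h1, mul_zero]
  have hr : ∀ l, M.resid Δ t l = M.mBetaL2 t l - (M.tangent Δ t).starProjection (M.mBetaL2 t l) :=
    fun l => rfl
  simp only [hr, smul_sub, Finset.sum_sub_distrib, sub_eq_zero] at hz
  rw [hz]
  exact Submodule.sum_mem _ fun l _ => Submodule.smul_mem _ _
    (Submodule.starProjection_apply_mem _ _)

/-- An element of the closed span of the nonparametric directions is, in its `j`-th component and
conditionally on `W̃`, a nonparametric direction. -/
theorem exists_condExp_eq_of_mem_tangent [IsProbabilityMeasure P] (M : CCAPM P J q) {Δ : ℝ}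
    {t : ℤ} (hreg : M.Regular Δ t) (hΔ : 0 < Δ) {w : (Fin q → ℝ) → (Fin k → ℝ)}
    (hw : Measurable w) (hpdf : HasPDF (fun ω => (M.c (t + 1) ω, M.Wtilde w t ω)) P volume)
    {j : Fin J} (hHS : M.HilbertSchmidt w t j)
    {f : Lp (EuclideanSpace ℝ (Fin J)) 2 P} (hf : f ∈ M.tangent Δ t) :
    ∃ g : ℝ → ℝ, Measurable g ∧ Integrable (fun ω => M.A t j ω * g (M.c (t + 1) ω)) P ∧
      P[fun ω => f ω j | M.sigmaWtilde w t] =ᵐ[P] fun ω =>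
        (P[fun ω => M.A t j ω * g (M.c (t + 1) ω) | M.sigmaWtilde w t]) ω - g (M.c t ω) := by
  obtain ⟨C, hC, hb⟩ := hHS.exists_bound hw hpdf
  have hc := M.measurable_c (t + 1)
  have hc' := M.measurable_c t
  have hA := M.measurable_A t j
  have hW := M.measurable_Wtilde hw t
  have hm : M.sigmaWtilde w t ≤ ‹MeasurableSpace Ω› := hW.comap_le
  have hmW := M.sigmaWtilde_le_sigmaW hw t
  have hWm : M.sigmaW t ≤ ‹MeasurableSpace Ω› := (M.measurable_W t).comap_le
  obtain ⟨T, hT⟩ := exists_condExp_operator hc hW hA hC hb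
  have hmp : MeasurePreserving (M.c t) P (P.map (M.c (t + 1))) :=
    ⟨hc', (M.map_c_succ_eq hreg).symm⟩
  set S : Lp ℝ 2 (P.map (M.c (t + 1))) →L[ℝ] Lp ℝ 2 P :=
    (Lp.compMeasurePreservingₗᵢ ℝ (M.c t) hmp).toContinuousLinearMap with hS
  have hSc : ∀ g, S g =ᵐ[P] fun ω => g (M.c t ω) := fun g =>
    Lp.coeFn_compMeasurePreserving g hmp
  obtain ⟨s, b, -⟩ := exists_hilbertBasis ℝ (Lp ℝ 2 (P.map (M.c (t + 1))))
  have hclosed : IsClosed ((S - T).toLinearMap.range : Set (Lp ℝ 2 P)) :=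
    isClosed_range_isometry_sub b S T (fun x => LinearIsometry.norm_map _ x)
      (summable_norm_sq_condExp_operator hc hW hA hC hb T hT b.orthonormal)
  set L : Lp (EuclideanSpace ℝ (Fin J)) 2 P →L[ℝ] Lp ℝ 2 P :=
    ((lpMeas ℝ ℝ (M.sigmaWtilde w t) 2 P).subtypeL ∘L condExpL2 ℝ ℝ hm) ∘L
      (EuclideanSpace.proj (𝕜 := ℝ) j).compLpL 2 P with hL
  have hLc : ∀ f, L f =ᵐ[P] P[fun ω => f ω j | M.sigmaWtilde w t] := by
    intro f
    have h1 := MemLp.condExpL2_ae_eq_condExp (𝕜 := ℝ) hm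
      (Lp.memLp ((EuclideanSpace.proj (𝕜 := ℝ) j).compLpL 2 P f))
    rw [Lp.toLp_coeFn] at h1
    exact h1.trans (condExp_congr_ae
      ((EuclideanSpace.proj (𝕜 := ℝ) j).coeFn_compLpL (p := 2) (μ := P) f))
  -- Closedness of the range enters here: its preimage under `L` is a closed subspace, so only the
  -- generators need checking.
  have hle : M.tangent Δ t ≤ (S - T).toLinearMap.range.comap L.toLinearMap := by
    refine Submodule.topologicalClosure_minimal _ (Submodule.span_le.2 ?_)
      (hclosed.preimage L.continuous)
    rintro f ⟨g, hg, hfg⟩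
    obtain ⟨hint, hmem⟩ := M.integrable_and_memLp_A_mul hreg hΔ j hg
    have hfj : (fun ω => f ω j) =ᵐ[P] fun ω =>
        (P[fun ω => M.A t j ω * g (M.c (t + 1) ω) | M.sigmaW t]) ω - g (M.c t ω) := by
      filter_upwards [hfg] with ω hω
      rw [hω, mG]
    -- `g(c_t)` is the difference of `E[A_j g(c') | W]`, square-integrable because `g ∈ 𝒢`, and of a
    -- component of `f`, square-integrable by the choice of generators.
    have hgc : MemLp (fun ω => g (M.c t ω)) 2 P := by
      refine (memLp_congr_ae ?_).1 (hmem.sub ((Lp.memLp f).eval_piLp j))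
      filter_upwards [hfj] with ω hω
      rw [Pi.sub_apply, hω, sub_sub_cancel]
    have hgμ : MemLp g 2 (P.map (M.c (t + 1))) := by
      rw [M.map_c_succ_eq hreg]
      exact (memLp_map_measure_iff hg.1.aestronglyMeasurable hc'.aemeasurable).2 hgc
    have hgc1 : Integrable (fun ω => g (M.c t ω)) P := hgc.integrable one_le_two
    -- The sign turns `T g - S g` into a value of `S - T`; it is undone when the final witness is
    -- chosen.
    refine ⟨-hgμ.toLp g, ?_⟩
    change (S - T) (-hgμ.toLp g) = L f
    rw [map_neg, sub_apply, neg_sub]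
    refine Lp.ext ?_
    have hSg : S (hgμ.toLp g) =ᵐ[P] fun ω => g (M.c t ω) := by
      have h1 := hgμ.coeFn_toLp
      filter_upwards [hSc (hgμ.toLp g), hmp.quasiMeasurePreserving.ae h1] with ω h1 h2
      rw [h1, h2]
    have hTg : T (hgμ.toLp g) =ᵐ[P]
        P[fun ω => M.A t j ω * g (M.c (t + 1) ω) | M.sigmaWtilde w t] := by
      refine (hT _).trans (condExp_congr_ae ?_)
      filter_upwards [ae_of_ae_map hc.aemeasurable hgμ.coeFn_toLp] with ω hω
      rw [hω]
    have hLf : L f =ᵐ[P] fun ω =>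
        (P[fun ω => M.A t j ω * g (M.c (t + 1) ω) | M.sigmaWtilde w t]) ω - g (M.c t ω) := by
      refine (hLc f).trans ((condExp_congr_ae hfj).trans
        ((condExp_sub integrable_condExp hgc1 _).trans ?_))
      have hself : P[fun ω => g (M.c t ω) | M.sigmaWtilde w t] = fun ω => g (M.c t ω) :=
        condExp_of_stronglyMeasurable hm
          ((hg.1.comp measurable_snd).comp (comap_measurable (M.Wtilde w t))).stronglyMeasurable
          hgc1
      rw [hself]
      filter_upwards [condExp_condExp_of_le (μ := P)
        (f := fun ω => M.A t j ω * g (M.c (t + 1) ω)) hmW hWm] with ω hω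
      rw [Pi.sub_apply, hω]
    filter_upwards [Lp.coeFn_sub (T (hgμ.toLp g)) (S (hgμ.toLp g)), hSg, hTg, hLf]
      with ω h1 h2 h3 h4
    rw [h1, Pi.sub_apply, h2, h3, h4]
  obtain ⟨g, hg⟩ := hle hf
  change (S - T) g = L f at hg
  have hgm : Measurable g := (Lp.stronglyMeasurable g).measurable
  have hint : Integrable (fun ω => M.A t j ω * g (M.c (t + 1) ω)) P :=
    integrable_mul_comp_of_lintegral_le hc hW hA hC hb hgm (Lp.memLp g)
  refine ⟨fun x => -g x, hgm.neg, by simpa only [mul_neg] using hint.fun_neg, ?_⟩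
  have hneg : P[fun ω => M.A t j ω * -g (M.c (t + 1) ω) | M.sigmaWtilde w t] =ᵐ[P]
      -P[fun ω => M.A t j ω * g (M.c (t + 1) ω) | M.sigmaWtilde w t] := by
    simp only [mul_neg]
    exact condExp_neg _ _
  rw [sub_apply] at hg
  filter_upwards [hLc f, Lp.coeFn_sub (S g) (T g), hSc g, hT g, hneg] with ω h1 h2 h3 h4 h5
  rw [← h1, ← hg, h2, Pi.sub_apply, h3, h4, h5, Pi.neg_apply]
  ring

theorem det_PiMatrix_ne_zero [IsProbabilityMeasure P] (M : CCAPM P J q) {Δ : ℝ}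
    {t : ℤ} (hΔ : 0 < Δ) (hprice : M.Solves t M.g₀) (hreg : M.Regular Δ t)
    (hg₀ : P {ω | M.g₀ (M.c t ω) = 0} = 0) {w : (Fin q → ℝ) → (Fin k → ℝ)}
    (hw : Measurable w) (hpdf : HasPDF (fun ω => (M.c (t + 1) ω, M.Wtilde w t ω)) P volume)
    {j : Fin J} (hHS : M.HilbertSchmidt w t j) (hcomp : M.Complete w t j) :
    (M.PiMatrix Δ t).det ≠ 0 := by
  intro hdet
  obtain ⟨b, hb0, hb⟩ := M.exists_sum_smul_mem_tangent_of_det_eq_zero hdet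
  obtain ⟨g, hg, hgint, hgeq⟩ := M.exists_condExp_eq_of_mem_tangent hreg hΔ hw hpdf hHS hb
  have hc := M.measurable_c (t + 1)
  have hc' := M.measurable_c t
  have hW := M.measurable_Wtilde hw t
  have hm : M.sigmaWtilde w t ≤ ‹MeasurableSpace Ω› := hW.comap_le
  have hmW := M.sigmaWtilde_le_sigmaW hw t
  have hWm : M.sigmaW t ≤ ‹MeasurableSpace Ω› := (M.measurable_W t).comap_le
  have hg₀m := M.measurable_g₀
  set a : ℝ → ℝ := fun x => M.g₀ x * (b 0 / M.δ₀ - b 1 * Real.log x) - g x with ha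
  have ham : Measurable a := by fun_prop
  -- the `j`-th component of the combination of the columns, conditionally on `W̃`
  have hX := fun l => M.integrable_and_memLp_A_mul_g₀_mul_X hreg hΔ j l
  have haX : ∀ ω, M.A t j ω * a (M.c (t + 1) ω) =
      b 0 * (M.A t j ω * M.g₀ (M.c (t + 1) ω) * M.X t 0 ω) +
        b 1 * (M.A t j ω * M.g₀ (M.c (t + 1) ω) * M.X t 1 ω) -
        M.A t j ω * g (M.c (t + 1) ω) := by
    intro ω
    simp only [ha, X, Matrix.cons_val_zero, Matrix.cons_val_one]
    ring
  have h0 := (hX 0).1.const_mul (b 0)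
  have h1 := (hX 1).1.const_mul (b 1)
  have haint : Integrable (fun ω => M.A t j ω * a (M.c (t + 1) ω)) P := by
    simp only [haX]
    exact (h0.add h1).sub hgint
  have hsum : (fun ω => (∑ l, b l • M.mBetaL2 t l : Lp (EuclideanSpace ℝ (Fin J)) 2 P) ω j)
      =ᵐ[P] P[fun ω => b 0 * (M.A t j ω * M.g₀ (M.c (t + 1) ω) * M.X t 0 ω) +
        b 1 * (M.A t j ω * M.g₀ (M.c (t + 1) ω) * M.X t 1 ω) | M.sigmaW t] := by
    rw [Fin.sum_univ_two]
    filter_upwards [Lp.coeFn_add (b 0 • M.mBetaL2 t 0) (b 1 • M.mBetaL2 t 1),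
      Lp.coeFn_smul (b 0) (M.mBetaL2 t 0), Lp.coeFn_smul (b 1) (M.mBetaL2 t 1),
      M.mBetaL2_coeFn hreg hΔ 0, M.mBetaL2_coeFn hreg hΔ 1, condExp_add h0 h1 (M.sigmaW t),
      condExp_smul (b 0) (fun ω => M.A t j ω * M.g₀ (M.c (t + 1) ω) * M.X t 0 ω) (M.sigmaW t)
        (μ := P),
      condExp_smul (b 1) (fun ω => M.A t j ω * M.g₀ (M.c (t + 1) ω) * M.X t 1 ω) (M.sigmaW t)
        (μ := P)] with ω e1 e2 e3 e4 e5 e6 e7 e8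
    have e6' := e6.trans (congrArg₂ (· + ·) e7 e8)
    refine Eq.trans ?_ e6'.symm
    rw [e1, Pi.add_apply, e2, e3, Pi.smul_apply, Pi.smul_apply, e4, e5]
    simp [mBeta]
  have hacond : P[fun ω => M.A t j ω * a (M.c (t + 1) ω) | M.sigmaWtilde w t] =ᵐ[P]
      fun ω => -g (M.c t ω) := by
    simp only [haX]
    filter_upwards [condExp_sub (h0.add h1) hgint (M.sigmaWtilde w t), hgeq,
      condExp_congr_ae hsum (m := M.sigmaWtilde w t),
      condExp_condExp_of_le (μ := P)
        (f := fun ω => b 0 * (M.A t j ω * M.g₀ (M.c (t + 1) ω) * M.X t 0 ω) +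
        b 1 * (M.A t j ω * M.g₀ (M.c (t + 1) ω) * M.X t 1 ω)) hmW hWm] with ω e1 e2 e3 e4
    refine e1.trans ?_
    rw [Pi.sub_apply]
    have e5 := e4.symm.trans (e3.symm.trans e2)
    change (P[fun ω => b 0 * (M.A t j ω * M.g₀ (M.c (t + 1) ω) * M.X t 0 ω) +
        b 1 * (M.A t j ω * M.g₀ (M.c (t + 1) ω) * M.X t 1 ω) | M.sigmaWtilde w t]) ω - _ = _
    rw [e5]
    ring
  have hg₀cond : P[fun ω => M.A t j ω * M.g₀ (M.c (t + 1) ω) | M.sigmaWtilde w t] =ᵐ[P]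
      fun ω => M.g₀ (M.c t ω) := by
    have h1 := condExp_condExp_of_le (μ := P)
        (f := fun ω => M.A t j ω * M.g₀ (M.c (t + 1) ω)) hmW hWm
    refine h1.symm.trans ((condExp_congr_ae (hprice j).2).trans ?_)
    refine Filter.EventuallyEq.of_eq (condExp_of_stronglyMeasurable hm
      (f := fun ω => M.g₀ (M.c t ω)) ?_ ((integrable_congr (hprice j).2).1 integrable_condExp))
    exact ((hg₀m.comp measurable_snd).comp (comap_measurable (M.Wtilde w t))).stronglyMeasurable
  have hg₀c : ∀ᵐ ω ∂P, M.g₀ (M.c t ω) ≠ 0 := measure_eq_zero_iff_ae_notMem.1 hg₀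
  have hg₀c' : ∀ᵐ ω ∂P, M.g₀ (M.c (t + 1) ω) ≠ 0 := by
    have hs : MeasurableSet {x | M.g₀ x ≠ 0} := hg₀m (measurableSet_singleton (0 : ℝ)).compl
    have h1 : ∀ᵐ x ∂P.map (M.c t), M.g₀ x ≠ 0 := (ae_map_iff hc'.aemeasurable hs).2 hg₀c
    rw [← M.map_c_succ_eq hreg] at h1
    exact ae_of_ae_map hc.aemeasurable h1
  -- completeness, applied to truncations
  set B : ℕ → Set ℝ := fun n => {y | |g y / M.g₀ y| ≤ n} with hB
  have hBm : ∀ n, MeasurableSet (B n) := fun n => by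
    have : Measurable fun y => |g y / M.g₀ y| := by fun_prop
    exact measurableSet_le this measurable_const
  -- The function wanted is `a(c') + g₀(c') g(c)/g₀(c)`, but its product with `A_j` need not be
  -- integrable. Restricting to `c ∈ B n` makes the factors in `c` bounded; they then pull out of
  -- the conditional expectation, leaving `-g(c) + g₀(c) g(c)/g₀(c) = 0` on `B n`.
  set h : ℕ → ℝ × ℝ → ℝ := fun n z =>
    a z.1 * (B n).indicator (fun _ => 1) z.2 +
      M.g₀ z.1 * (B n).indicator (fun y => g y / M.g₀ y) z.2 with hh
  have hp : ∀ n, Measurable ((B n).indicator fun _ => (1 : ℝ)) := fun n =>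
    measurable_const.indicator (hBm n)
  have hr : ∀ n, Measurable ((B n).indicator fun y => g y / M.g₀ y) := fun n =>
    (hg.div hg₀m).indicator (hBm n)
  have hpb : ∀ n y, ‖(B n).indicator (fun _ => (1 : ℝ)) y‖ ≤ 1 := fun n y => by
    by_cases hy : y ∈ B n <;> simp [hy]
  have hrb : ∀ n y, ‖(B n).indicator (fun y => g y / M.g₀ y) y‖ ≤ n := fun n y => by
    by_cases hy : y ∈ B n
    · rw [Set.indicator_of_mem hy]
      exact hy
    · simp [hy]
  have hzero : ∀ n, ∀ᵐ ω ∂P, h n (M.c (t + 1) ω, M.c t ω) = 0 := by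
    intro n
    have hsplit : ∀ ω, M.A t j ω * h n (M.c (t + 1) ω, M.c t ω) =
        M.A t j ω * a (M.c (t + 1) ω) * (B n).indicator (fun _ => 1) (M.c t ω) +
        M.A t j ω * M.g₀ (M.c (t + 1) ω) *
          (B n).indicator (fun y => g y / M.g₀ y) (M.c t ω) := fun ω => by
      simp only [hh]
      ring
    have i1 : Integrable (fun ω =>
        M.A t j ω * a (M.c (t + 1) ω) * (B n).indicator (fun _ => 1) (M.c t ω)) P :=
      haint.mul_bdd ((hp n).comp hc').aestronglyMeasurable (ae_of_all _ fun ω => hpb n _)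
    have i2 : Integrable (fun ω => M.A t j ω * M.g₀ (M.c (t + 1) ω) *
        (B n).indicator (fun y => g y / M.g₀ y) (M.c t ω)) P :=
      (hprice j).1.mul_bdd ((hr n).comp hc').aestronglyMeasurable (ae_of_all _ fun ω => hrb n _)
    refine hcomp (h n) ?_ ?_ ?_
    · exact ((ham.comp measurable_fst).mul ((hp n).comp measurable_snd)).add
        ((hg₀m.comp measurable_fst).mul ((hr n).comp measurable_snd))
    · simp only [hsplit]
      exact i1.add i2
    · simp only [hsplit]
      have e1 := condExp_mul_of_stronglyMeasurable_right (m := M.sigmaWtilde w t)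
        (((hp n).comp measurable_snd).comp (comap_measurable (M.Wtilde w t))).stronglyMeasurable
        i1 haint
      have e2 := condExp_mul_of_stronglyMeasurable_right (m := M.sigmaWtilde w t)
        (((hr n).comp measurable_snd).comp (comap_measurable (M.Wtilde w t))).stronglyMeasurable
        i2 (hprice j).1
      refine (condExp_add i1 i2 _).trans ?_
      filter_upwards [e1, e2, hacond, hg₀cond, hg₀c] with ω e1 e2 e3 e4 e5
      have e1' := e1.trans (congrArg₂ (· * ·) e3 rfl)
      have e2' := e2.trans (congrArg₂ (· * ·) e4 rfl)
      refine (congrArg₂ (· + ·) e1' e2').trans ?_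
      simp only [Function.comp_apply, Wtilde, Pi.zero_apply]
      by_cases hy : M.c t ω ∈ B n
      · rw [Set.indicator_of_mem hy, Set.indicator_of_mem hy]
        field_simp
        ring
      · rw [Set.indicator_of_notMem hy, Set.indicator_of_notMem hy]
        ring
  have hinc : ∀ᵐ ω ∂P, b 0 / M.δ₀ - b 1 * Real.log (M.c (t + 1) ω) =
      g (M.c (t + 1) ω) / M.g₀ (M.c (t + 1) ω) - g (M.c t ω) / M.g₀ (M.c t ω) := by
    filter_upwards [ae_all_iff.2 hzero, hg₀c'] with ω e1 e2
    obtain ⟨n, hn⟩ := exists_nat_ge |g (M.c t ω) / M.g₀ (M.c t ω)|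
    have e3 := e1 n
    have hy : M.c t ω ∈ B n := hn
    simp only [hh, ha, Set.indicator_of_mem hy] at e3
    rw [eq_sub_iff_add_eq, eq_div_iff e2]
    linear_combination e3
  have hpdf1 := (M.hasPDF_marginals w t hpdf).1
  obtain ⟨r1, r2⟩ := affine_log_eq_zero_of_eq_increment hc hc' (M.map_c_succ_eq hreg)
    (M.c_pos (t + 1)) hpdf1.absolutelyContinuous (M.map_c_c_absolutelyContinuous hw t hpdf)
    (hg.div hg₀m) hinc
  refine hb0 (funext fun l => ?_)
  fin_cases l
  · exact (div_eq_zero_iff.1 r1).resolve_right M.δ₀_pos.ne'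
  · exact r2

/-- Under completeness at `cbar`, the solution of the pricing equation that also holds at `cbar`
is unique up to scale. -/
theorem unique_up_to_scale (M : CCAPM P J q) {t : ℤ}
    (hprice : M.Solves t M.g₀) {w : (Fin q → ℝ) → (Fin k → ℝ)} (hw : Measurable w) {j : Fin J}
    {Q : Kernel ℝ ((Fin q → ℝ) × EuclideanSpace ℝ (Fin J) × ℝ)} [IsMarkovKernel Q] {cbar : ℝ}
    (hcbar : M.g₀ cbar ≠ 0) (hat : M.SolvesAt Q cbar M.g₀) (hcomp : M.CompleteAt w t j Q cbar)
    {g : ℝ → ℝ} (hg : Measurable g) (hgs : M.Solves t g) (hgat : M.SolvesAt Q cbar g) :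
    ∃ a : ℝ, g cbar = a * M.g₀ cbar ∧
      ∀ᵐ ω ∂P, g (M.c (t + 1) ω) = a * M.g₀ (M.c (t + 1) ω) := by
  set a := g cbar / M.g₀ cbar with ha
  have hga : g cbar = a * M.g₀ cbar := by rw [ha, div_mul_cancel₀ _ hcbar]
  refine ⟨a, hga, ?_⟩
  have i1 := (hgat j).1
  have i2 := (hat j).1.const_mul a
  have hsplit : ∀ p : (Fin q → ℝ) × EuclideanSpace ℝ (Fin J) × ℝ,
      M.disc j p.2.1 p.2.2 * (g p.2.2 - a * M.g₀ p.2.2) =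
      M.disc j p.2.1 p.2.2 * g p.2.2 - a * (M.disc j p.2.1 p.2.2 * M.g₀ p.2.2) :=
    fun p => by ring
  have hle : MeasurableSpace.comap
      (fun p : (Fin q → ℝ) × EuclideanSpace ℝ (Fin J) × ℝ => w p.1) inferInstance ≤
      MeasurableSpace.comap
        (fun p : (Fin q → ℝ) × EuclideanSpace ℝ (Fin J) × ℝ => p.1) inferInstance := by
    have : (fun p : (Fin q → ℝ) × EuclideanSpace ℝ (Fin J) × ℝ => w p.1) = w ∘ fun p => p.1 := rfl
    rw [this, ← MeasurableSpace.comap_comp]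
    exact MeasurableSpace.comap_mono hw.comap_le
  have hZ : (Q cbar)[fun p => M.disc j p.2.1 p.2.2 * (g p.2.2 - a * M.g₀ p.2.2) |
      MeasurableSpace.comap (fun p => p.1) inferInstance] =ᵐ[Q cbar] 0 := by
    simp only [hsplit]
    filter_upwards [condExp_sub i1 i2 (MeasurableSpace.comap (fun p => p.1) inferInstance),
      condExp_smul (μ := Q cbar) a (fun p : (Fin q → ℝ) × EuclideanSpace ℝ (Fin J) × ℝ =>
        M.disc j p.2.1 p.2.2 * M.g₀ p.2.2) (MeasurableSpace.comap (fun p => p.1) inferInstance),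
      (hgat j).2, (hat j).2] with p e1 e2 e3 e4
    refine e1.trans ((congrArg₂ (· - ·) e3 e2).trans ?_)
    simp only [Pi.smul_apply, smul_eq_mul, Pi.zero_apply]
    rw [e4, hga, sub_self]
  have hmain := hcomp (fun x => g x - a * M.g₀ x) (hg.sub (M.measurable_g₀.const_mul a)) (by
      have : ∀ ω, M.A t j ω * (g (M.c (t + 1) ω) - a * M.g₀ (M.c (t + 1) ω)) =
          M.A t j ω * g (M.c (t + 1) ω) - a * (M.A t j ω * M.g₀ (M.c (t + 1) ω)) :=
        fun ω => by ring
      simp only [this]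
      exact (hgs j).1.sub ((hprice j).1.const_mul a))
    (by
      simp only [hsplit]
      exact i1.sub i2)
    (by
      refine (condExp_condExp_of_le (μ := Q cbar) hle measurable_fst.comap_le).symm.trans ?_
      refine (condExp_congr_ae hZ).trans ?_
      rw [condExp_zero])
  filter_upwards [hmain] with ω hω
  linarith

end CCAPM

theorem theorem12 {Ω : Type*} [MeasurableSpace Ω] (P : Measure Ω) [IsProbabilityMeasure P]
    {J q k : ℕ} (M : CCAPM P J q) (t : ℤ) (Δ : ℝ) (hΔ : 0 < Δ)
    -- the pricing equation
    (hprice : M.Solves t M.g₀)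
    -- the regularity conditions
    (hreg : M.Regular Δ t)
    (hg₀ : P {ω | M.g₀ (M.c t ω) = 0} = 0)
    (w : (Fin q → ℝ) → (Fin k → ℝ)) (hw : Measurable w)
    (hpdf : HasPDF (fun ω => (M.c (t + 1) ω, M.Wtilde w t ω)) P volume)
    (j : Fin J) (hHS : M.HilbertSchmidt w t j) :
    -- the columns of `m'_β` are square-integrable, so that `Π` is well defined
    (∀ l, MemLp (M.mBeta t l) 2 P) ∧
    -- (a)
    (M.Complete w t j → (M.PiMatrix Δ t).det ≠ 0) ∧
    -- (b)
    (∀ (Q : Kernel ℝ ((Fin q → ℝ) × EuclideanSpace ℝ (Fin J) × ℝ)), M.IsCondLaw t Q →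
      ∀ cbar : ℝ, M.g₀ cbar ≠ 0 → M.SolvesAt Q cbar M.g₀ → M.CompleteAt w t j Q cbar →
        ∀ g : ℝ → ℝ, Measurable g → M.Solves t g → M.SolvesAt Q cbar g →
          ∃ a : ℝ, g cbar = a * M.g₀ cbar ∧
            ∀ᵐ ω ∂P, g (M.c (t + 1) ω) = a * M.g₀ (M.c (t + 1) ω)) := by
  refine ⟨M.memLp_mBeta hreg hΔ, M.det_PiMatrix_ne_zero hΔ hprice hreg hg₀ hw hpdf hHS, ?_⟩
  intro Q hQ cbar hcbar hat hcomp g hg hgs hgat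
  have := hQ.1
  exact M.unique_up_to_scale hprice hw hcbar hat hcomp hg hgs hgat
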